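/- Let $\Lambda\subset\mathbb R^2$ be a lattice (the group generated by two linearly independent translations), let $\mathbb T=\mathbb R^2/\Lambda$ be the corresponding flat torus with projection $\rho:\mathbb R^2\to\mathbb T$, and let $V\subset\mathbb T$ be a finite set. A geometric triangulation of $\mathbb T$ with vertex set $V$ is a finite triangulation with interior-disjoint locally geodesic edges (loops and multiple edges are allowed); equivalently, its inverse image under $\rho$ is a $\Lambda$-invariant face-to-face triangulation of $\mathbb R^2$ by non-degenerate Euclidean triangles with vertex set $\rho^{-1}(V)$. It is Delaunay if each lifted triangle is inscribed in an open disk that contains no point of $\rho^{-1}(V)$. If $abc$ and $bad$ are two distinct lifted triangles sharing the edge $ab$, flipping this edge replaces the projections to $\mathbb T$ of $abc$ and $bad$ by those of $cdb$ and $dca$. The edge is Delaunay flippable if, after the flip, $a$ lies outside the closed disk inscribing $cdb$ and $b$ lies outside the closed disk inscribing $dca$; the flip is then called a Delaunay flip. The flip algorithm performs Delaunay flips, in any order, until there is no Delaunay flippable edge. The set $V$ is non-degenerate if in no Delaunay triangulation with vertex set $V$ two adjacent lifted triangles have cocircular vertices. Theorem. Let $T$ be a geometric triangulation of a flat torus $\mathbb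 T$ with finite vertex set $V$. Then the flip algorithm started from $T$ terminates: there is no infinite sequence of Delaunay flips starting from $T$, whatever the order of the flips, and the algorithm has an output. Every output is a Delaunay triangulation of $\mathbb T$ with vertex set $V$. If $V$ is non-degenerate, the output is the unique Delaunay triangulation of $\mathbb T$ with vertex set $V$. -/

import Mathlib

open scoped Pointwise

namespace FlatTorus

/-- The Euclidean plane, which is the universal cover of every flat torus. -/
abbrev Plane : Type := EuclideanSpace ℝ (Fin 2)

/-- The flat torus `ℝ² / L`, where `L` is a lattice of translations of the plane. -/
abbrev Torus (L : Submodule ℤ Plane) : Type := Plane ⧸ L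

/-- The projection `ρ` from the universal cover to the torus. -/
def proj (L : Submodule ℤ Plane) : Plane → Torus L := fun x => L.mkQ x

/-- A Euclidean triangle in the plane, given by its set of vertices. -/
def IsTriangle (t : Set Plane) : Prop :=
  ∃ a b c : Plane, AffineIndependent ℝ ![a, b, c] ∧ t = {a, b, c}

/-- A locally geodesic triangle on the torus is a triangle of the plane up to the translations of
`L`.  It is not determined by the images of its vertices, so loops and multiple edges are
allowed.  (The type consists of the `L`-orbits of all sets of points of the plane; only orbits of
triangles occur in a geometric triangulation.) -/
abbrev TorusFace (L : Submodule ℤ Plane) : Type :=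
  AddAction.orbitRel.Quotient L (Set Plane)

/-- The projection to the torus of the triangle with vertex set `t`. -/
def projFace (L : Submodule ℤ Plane) (t : Set Plane) : TorusFace L :=
  Quotient.mk (AddAction.orbitRel L (Set Plane)) t

/-- The faces of the inverse image in the plane of a family `T` of faces on the torus: all lifts
of all faces in `T`. -/
def lifts (L : Submodule ℤ Plane) (T : Set (TorusFace L)) : Set (Set Plane) :=
  {t | projFace L t ∈ T}

/-- `T` is (the set of faces of) a geometric triangulation of the torus `ℝ² / L` with vertex set
`V`: it has finitely many faces, and its inverse image is a triangulation of the plane by Euclidean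
triangles whose set of vertices is the inverse image of `V`, i.e. the triangles cover the plane and
any two of them meet exactly in a common face (a vertex, an edge, or a whole triangle), if they
meet at all. -/
structure IsGeometricTriangulation (L : Submodule ℤ Plane) (V : Set (Torus L))
    (T : Set (TorusFace L)) : Prop where
  finite : T.Finite
  isTriangle : ∀ t ∈ lifts L T, IsTriangle t
  vertices : ⋃₀ lifts L T = proj L ⁻¹' V
  cover : ⋃ t ∈ lifts L T, convexHull ℝ t = Set.univ
  inter : ∀ s ∈ lifts L T, ∀ t ∈ lifts L T,
    convexHull ℝ s ∩ convexHull ℝ t ⊆ convexHull ℝ (s ∩ t)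

/-- The Delaunay property: each lift of each face is inscribed in an open disk which contains no
vertex of the inverse image of the triangulation. -/
def IsDelaunay (L : Submodule ℤ Plane) (T : Set (TorusFace L)) : Prop :=
  ∀ t ∈ lifts L T, ∃ (x : Plane) (r : ℝ),
    t ⊆ Metric.sphere x r ∧ Disjoint (Metric.ball x r) (⋃₀ lifts L T)

/-- `T` is a Delaunay triangulation of the torus `ℝ² / L` with vertex set `V`. -/
def IsDelaunayTriangulation (L : Submodule ℤ Plane) (V : Set (Torus L))
    (T : Set (TorusFace L)) : Prop :=
  IsGeometricTriangulation L V T ∧ IsDelaunay L T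

/-- `{a, b, c}` and `{b, a, d}` are distinct triangles of the inverse image of `T` which share the
edge `ab`. -/
def AdjacentLifts (L : Submodule ℤ Plane) (T : Set (TorusFace L)) (a b c d : Plane) : Prop :=
  {a, b, c} ∈ lifts L T ∧ {b, a, d} ∈ lifts L T ∧ c ≠ d

/-- The triangle `pqr` is inscribed in a circle and the point `z` lies outside the closed disk
bounded by it. -/
def OutsideCircumdisk (p q r z : Plane) : Prop :=
  ∃ (x : Plane) (ρ : ℝ), {p, q, r} ⊆ Metric.sphere x ρ ∧ z ∉ Metric.closedBall x ρ

/-- The projection of the edge `ab`, shared by the adjacent lifted triangles `abc` and `bad`, is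
Delaunay flippable: after replacing the diagonal `ab` by `cd`, the disk inscribing `cdb` does not
contain `a`, and the disk inscribing `dca` does not contain `b`. -/
def DelaunayFlippable (L : Submodule ℤ Plane) (T : Set (TorusFace L)) (a b c d : Plane) : Prop :=
  AdjacentLifts L T a b c d ∧ OutsideCircumdisk c d b a ∧ OutsideCircumdisk d c a b

/-- Flip the projection of the edge `ab`: the projections of the triangles `abc` and `bad` are
replaced by the projections of the triangles `cdb` and `dca`. -/
def flip (L : Submodule ℤ Plane) (T : Set (TorusFace L)) (a b c d : Plane) : Set (TorusFace L) :=
  (T \ {projFace L {a, b, c}, projFace L {b, a, d}}) ∪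
    {projFace L {c, d, b}, projFace L {d, c, a}}

/-- One step of the flip algorithm: `T'` is obtained from `T` by some Delaunay flip. -/
def DelaunayFlip (L : Submodule ℤ Plane) (T T' : Set (TorusFace L)) : Prop :=
  ∃ a b c d : Plane, DelaunayFlippable L T a b c d ∧ T' = flip L T a b c d

/-- `T'` is a possible output of the flip algorithm on the input `T`: it is reached from `T` by
finitely many Delaunay flips, and has no Delaunay flippable edge. -/
def IsFlipOutput (L : Submodule ℤ Plane) (T T' : Set (TorusFace L)) : Prop :=
  Relation.ReflTransGen (DelaunayFlip L) T T' ∧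
    ¬ ∃ a b c d : Plane, DelaunayFlippable L T' a b c d

/-- `V` is non-degenerate: in no Delaunay triangulation with vertex set `V` do two adjacent lifted
triangles have cocircular vertices. -/
def NonDegenerate (L : Submodule ℤ Plane) (V : Set (Torus L)) : Prop :=
  ∀ T : Set (TorusFace L), IsDelaunayTriangulation L V T →
    ∀ a b c d : Plane, AdjacentLifts L T a b c d →
      ¬ ∃ (x : Plane) (r : ℝ), {a, b, c, d} ⊆ Metric.sphere x r

end FlatTorus

/-! Circles are handled through their power functions `pw m`, negative inside the disk and zero on
the circle. Two facts drive everything: each `pw m` is convex, and the difference of two of them is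
affine.

Termination. Give each face on the torus the number of lifted vertices inside the open circumdisk of
one of its lifts, and sum over the faces (`totalWeight`). A Delaunay flip happens in a strictly
convex quadrilateral, and there the union and the intersection of the two new disks are contained in
the union and the intersection of the two old ones (`DiskConfig.union`, `DiskConfig.inter`).
Inclusion-exclusion bounds the new weight by the old one, strictly, because `d` lies in the disk of
`abc` but on both new circles (`DiskConfig.ncard_lt`). Flips preserve geometric triangulations
(`IsGeometricTriangulation.flip`), so the natural number keeps dropping and the algorithm stops.

Correctness. If the vertex opposite a shared edge lies in the neighbouring disk, the edge is
flippable (`AdjacentLifts.flippable_of_inDisk`), so an output is locally Delaunay. Suppose a vertex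
`p` lay in some circumdisk. Among the finitely many edges that separate `p` from a triangle whose
disk contains `p`, take one seen from `p` under the largest angle. The triangle across it still has
`p` in its disk, and another of its edges separates it from `p` and is seen under a larger angle
(`exists_viewCot_lt`), a contradiction (`IsGeometricTriangulation.not_inDisk`).

Uniqueness. Overlapping triangles of two Delaunay triangulations have the same circumcircle, and
non-degeneracy then forces them to be equal (`eq_of_overlap`). Each triangle of one triangulation
overlaps some triangle of the other (`IsGeometricTriangulation.exists_overlap`). -/

namespace FlatTorus

/-! ### Signed areas, barycentric coordinates and convex hulls -/

/-- Twice the signed area of the triangle `abc`. -/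
def cr (a b c : Plane) : ℝ :=
  (b 0 - a 0) * (c 1 - a 1) - (b 1 - a 1) * (c 0 - a 0)

/-- The power of a point with respect to a circle given by the coefficients of its equation. -/
def pw (m : ℝ × ℝ × ℝ) (x : Plane) : ℝ :=
  x 0 ^ 2 + x 1 ^ 2 - m.1 * x 0 - m.2.1 * x 1 - m.2.2

theorem plane_ext {x y : Plane} (h0 : x 0 = y 0) (h1 : x 1 = y 1) : x = y := by
  ext i; fin_cases i <;> assumption

theorem dist_sq_eq (x y : Plane) : dist x y ^ 2 = (x 0 - y 0) ^ 2 + (x 1 - y 1) ^ 2 := by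
  rw [EuclideanSpace.dist_eq, Real.sq_sqrt (by positivity), Fin.sum_univ_two, Real.dist_eq,
    Real.dist_eq, sq_abs, sq_abs]

theorem collinear_triple_iff (a b c : Plane) : Collinear ℝ {a, b, c} ↔ cr a b c = 0 := by
  rw [collinear_iff_of_mem (Set.mem_insert a _)]
  constructor
  · rintro ⟨v, hv⟩
    obtain ⟨r, hr⟩ := hv b (by simp)
    obtain ⟨s, hs⟩ := hv c (by simp)
    simp only [hr, hs, cr, vadd_eq_add, PiLp.add_apply, PiLp.smul_apply, smul_eq_mul]
    ring
  · intro h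
    unfold cr at h
    by_cases hb : b = a
    · refine ⟨c - a, ?_⟩
      simp only [Set.mem_insert_iff, Set.mem_singleton_iff, forall_eq_or_imp, forall_eq]
      exact ⟨⟨0, by simp⟩, ⟨0, by simp [hb]⟩, ⟨1, by simp⟩⟩
    · refine ⟨b - a, ?_⟩
      simp only [Set.mem_insert_iff, Set.mem_singleton_iff, forall_eq_or_imp, forall_eq]
      refine ⟨⟨0, by simp⟩, ⟨1, by simp⟩, ?_⟩
      by_cases h0 : b 0 - a 0 = 0
      · have h1 : b 1 - a 1 ≠ 0 := fun h1 => hb (plane_ext (by linarith) (by linarith))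
        refine ⟨(c 1 - a 1) / (b 1 - a 1), plane_ext ?_ ?_⟩ <;>
        simp only [vadd_eq_add, PiLp.add_apply, PiLp.smul_apply, smul_eq_mul, PiLp.sub_apply] <;>
        field_simp <;> linarith
      · refine ⟨(c 0 - a 0) / (b 0 - a 0), plane_ext ?_ ?_⟩ <;>
        simp only [vadd_eq_add, PiLp.add_apply, PiLp.smul_apply, smul_eq_mul, PiLp.sub_apply] <;>
        field_simp <;> linarith

theorem isTriangle_triple_iff {a b c : Plane} : IsTriangle {a, b, c} ↔ cr a b c ≠ 0 := by
  rw [Ne, ← collinear_triple_iff]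
  constructor
  · rintro ⟨a', b', c', h, e⟩
    rw [e]
    exact affineIndependent_iff_not_collinear_set.mp h
  · intro h
    exact ⟨a, b, c, affineIndependent_iff_not_collinear_set.mpr h, rfl⟩

theorem IsTriangle.exists_cr {t : Set Plane} (h : IsTriangle t) :
    ∃ a b c, cr a b c ≠ 0 ∧ t = {a, b, c} := by
  obtain ⟨a, b, c, hi, e⟩ := h
  exact ⟨a, b, c, isTriangle_triple_iff.mp ⟨a, b, c, hi, rfl⟩, e⟩

theorem IsTriangle.exists_cr_pos {t : Set Plane} (h : IsTriangle t) :
    ∃ a b c, 0 < cr a b c ∧ t = {a, b, c} := by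
  obtain ⟨a, b, c, hi, e⟩ := h.exists_cr
  rcases lt_or_gt_of_ne hi with h | h
  · refine ⟨b, a, c, ?_, by rw [e, Set.insert_comm]⟩
    unfold cr at *; linarith
  · exact ⟨a, b, c, h, e⟩

theorem mem_hull_triple {a b c x : Plane} : x ∈ convexHull ℝ {a, b, c} ↔
    ∃ α β γ : ℝ, 0 ≤ α ∧ 0 ≤ β ∧ 0 ≤ γ ∧ α + β + γ = 1 ∧
      x 0 = α * a 0 + β * b 0 + γ * c 0 ∧ x 1 = α * a 1 + β * b 1 + γ * c 1 := by
  constructor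
  · intro h
    rw [convexHull_insert (by simp), convexHull_pair, mem_convexJoin] at h
    obtain ⟨a', ha', y, hy, hx⟩ := h
    rw [Set.mem_singleton_iff] at ha'
    subst ha'
    obtain ⟨p, q, hp, hq, hpq, rfl⟩ := hy
    obtain ⟨r, s, hr, hs, hrs, rfl⟩ := hx
    refine ⟨r, s * p, s * q, hr, by positivity, by positivity, ?_, ?_, ?_⟩
    · rw [add_assoc, ← mul_add, hpq, mul_one, hrs]
    all_goals
      simp only [PiLp.add_apply, PiLp.smul_apply, smul_eq_mul]
      ring
  · rintro ⟨α, β, γ, hα, hβ, hγ, h, h0, h1⟩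
    have e : x = α • a + β • b + γ • c := by
      apply plane_ext <;> simp only [PiLp.add_apply, PiLp.smul_apply, smul_eq_mul] <;> assumption
    rw [e]
    have hc := convex_convexHull ℝ ({a, b, c} : Set Plane)
    have key := hc.sum_mem (t := (Finset.univ : Finset (Fin 3))) (w := ![α, β, γ])
      (z := ![a, b, c]) (by intro i _; fin_cases i <;> assumption)
      (by simp [Fin.sum_univ_three, h])
      (by intro i _; apply subset_convexHull; fin_cases i <;> simp)
    simpa [Fin.sum_univ_three] using key

theorem mem_hull_pair {a b x : Plane} : x ∈ convexHull ℝ {a, b} ↔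
    ∃ α β : ℝ, 0 ≤ α ∧ 0 ≤ β ∧ α + β = 1 ∧
      x 0 = α * a 0 + β * b 0 ∧ x 1 = α * a 1 + β * b 1 := by
  rw [convexHull_pair]
  constructor
  · rintro ⟨p, q, hp, hq, hpq, rfl⟩
    exact ⟨p, q, hp, hq, hpq, by simp, by simp⟩
  · rintro ⟨p, q, hp, hq, hpq, h0, h1⟩
    exact ⟨p, q, hp, hq, hpq, by apply plane_ext <;> simp [h0, h1]⟩

/-- Membership in a positively oriented triangle by signed areas. -/
theorem mem_hull_of_cr {a b c x : Plane} (h : 0 < cr a b c) (h1 : 0 ≤ cr a b x)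
    (h2 : 0 ≤ cr b c x) (h3 : 0 ≤ cr c a x) : x ∈ convexHull ℝ {a, b, c} := by
  rw [mem_hull_triple]
  refine ⟨cr b c x / cr a b c, cr c a x / cr a b c, cr a b x / cr a b c, by positivity,
    by positivity, by positivity, ?_, ?_, ?_⟩
  all_goals
    field_simp
    unfold cr
    ring

/-- Barycentric coordinates with respect to a non-degenerate triangle. -/
theorem exists_barycentric {a b c : Plane} (h : cr a b c ≠ 0) (x : Plane) :
    ∃ α β γ : ℝ, α + β + γ = 1 ∧
      x 0 = α * a 0 + β * b 0 + γ * c 0 ∧ x 1 = α * a 1 + β * b 1 + γ * c 1 := by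
  refine ⟨cr b c x / cr a b c, cr c a x / cr a b c, cr a b x / cr a b c, ?_, ?_, ?_⟩
  all_goals
    field_simp
    unfold cr
    ring

/-! ### Circles and their power functions -/

theorem exists_circle {a b c : Plane} (h : cr a b c ≠ 0) :
    ∃ m, pw m a = 0 ∧ pw m b = 0 ∧ pw m c = 0 := by
  have h' := h
  unfold cr at h'
  set A := a 0 ^ 2 + a 1 ^ 2
  set B := b 0 ^ 2 + b 1 ^ 2 - A with hB
  set C := c 0 ^ 2 + c 1 ^ 2 - A with hC
  -- Cramer's rule for the linear system saying that `b` and `c` have the same power as `a`; the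
  -- constant coefficient then makes that power zero.
  set u := (B * (c 1 - a 1) - C * (b 1 - a 1)) / cr a b c with hu
  set v := (C * (b 0 - a 0) - B * (c 0 - a 0)) / cr a b c with hv
  have e1 : u * (b 0 - a 0) + v * (b 1 - a 1) = B := by
    rw [hu, hv]; field_simp; unfold cr; ring
  have e2 : u * (c 0 - a 0) + v * (c 1 - a 1) = C := by
    rw [hu, hv]; field_simp; unfold cr; ring
  refine ⟨(u, v, A - u * a 0 - v * a 1), ?_, ?_, ?_⟩ <;> unfold pw <;> simp only <;> linarith

/-- The difference of two power functions is affine. -/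
theorem pw_sub_barycentric (m n : ℝ × ℝ × ℝ) {a b c x : Plane} {α β γ : ℝ} (h : α + β + γ = 1)
    (h0 : x 0 = α * a 0 + β * b 0 + γ * c 0) (h1 : x 1 = α * a 1 + β * b 1 + γ * c 1) :
    pw m x - pw n x = α * (pw m a - pw n a) + β * (pw m b - pw n b) + γ * (pw m c - pw n c) := by
  unfold pw
  rw [h0, h1]
  linear_combination (m.2.2 - n.2.2) * (h)

theorem circle_unique {a b c : Plane} (h : cr a b c ≠ 0) {m n : ℝ × ℝ × ℝ}
    (ha : pw m a = pw n a) (hb : pw m b = pw n b) (hc : pw m c = pw n c) (x : Plane) :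
    pw m x = pw n x := by
  obtain ⟨α, β, γ, hs, h0, h1⟩ := exists_barycentric h x
  have := pw_sub_barycentric m n hs h0 h1
  rw [ha, hb, hc] at this
  linarith

/-- The subtracted term is the exact Jensen gap of the squared norm; the affine part of `pw`
contributes nothing to it. -/
theorem pw_barycentric (m : ℝ × ℝ × ℝ) {a b c x : Plane} {α β γ : ℝ} (h : α + β + γ = 1)
    (h0 : x 0 = α * a 0 + β * b 0 + γ * c 0) (h1 : x 1 = α * a 1 + β * b 1 + γ * c 1) :
    pw m x = α * pw m a + β * pw m b + γ * pw m c -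
      (α * β * dist a b ^ 2 + α * γ * dist a c ^ 2 + β * γ * dist b c ^ 2) := by
  have hα : α = 1 - β - γ := by linarith
  subst hα
  simp only [dist_sq_eq]
  unfold pw
  rw [h0, h1]
  ring

theorem pw_le_of_barycentric (m : ℝ × ℝ × ℝ) {a b c x : Plane} {α β γ : ℝ} (h : α + β + γ = 1)
    (hα : 0 ≤ α) (hβ : 0 ≤ β) (hγ : 0 ≤ γ)
    (h0 : x 0 = α * a 0 + β * b 0 + γ * c 0) (h1 : x 1 = α * a 1 + β * b 1 + γ * c 1) :
    pw m x ≤ α * pw m a + β * pw m b + γ * pw m c := by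
  rw [pw_barycentric m h h0 h1]
  have : 0 ≤ α * β * dist a b ^ 2 + α * γ * dist a c ^ 2 + β * γ * dist b c ^ 2 := by positivity
  linarith

/-- The difference of the powers is affine and vanishes at `a` and `b`, so it is proportional to `cr
a b`. The cross-multiplied form needs no non-degeneracy. -/
theorem pw_sub_cr (m n : ℝ × ℝ × ℝ) {a b : Plane} (ha : pw m a = pw n a) (hb : pw m b = pw n b)
    (d p : Plane) : cr a b d * (pw m p - pw n p) = cr a b p * (pw m d - pw n d) := by
  have key : cr a b d * (pw m p - pw n p) = cr b d p * (pw m a - pw n a) +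
      cr d a p * (pw m b - pw n b) + cr a b p * (pw m d - pw n d) := by
    unfold pw cr
    ring
  rw [key, ha, hb]
  ring

/-- The power function of the circle with centre `o` and radius `r`. -/
theorem exists_pw_eq (o : Plane) (r : ℝ) : ∃ m, ∀ x, pw m x = dist x o ^ 2 - r ^ 2 :=
  ⟨(2 * o 0, 2 * o 1, r ^ 2 - o 0 ^ 2 - o 1 ^ 2), fun x => by
    rw [dist_sq_eq]; unfold pw; ring⟩

theorem exists_center {m : ℝ × ℝ × ℝ} {q : Plane} (hq : pw m q = 0) :
    ∃ (o : Plane) (r : ℝ), 0 ≤ r ∧ ∀ x, pw m x = dist x o ^ 2 - r ^ 2 := by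
  have key : ∀ x : Plane, pw m x = dist x (!₂[m.1 / 2, m.2.1 / 2] : Plane) ^ 2 -
      (m.2.2 + (m.1 / 2) ^ 2 + (m.2.1 / 2) ^ 2) := by
    intro x
    rw [dist_sq_eq]
    unfold pw
    simp
    ring
  have hnn : 0 ≤ m.2.2 + (m.1 / 2) ^ 2 + (m.2.1 / 2) ^ 2 := by
    have := key q
    rw [hq] at this
    nlinarith [sq_nonneg (dist q (!₂[m.1 / 2, m.2.1 / 2] : Plane))]
  exact ⟨_, √(m.2.2 + (m.1 / 2) ^ 2 + (m.2.1 / 2) ^ 2), Real.sqrt_nonneg _, fun x => by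
    rw [Real.sq_sqrt hnn]; exact key x⟩

theorem sphere_iff_pw {o : Plane} {r : ℝ} (hr : 0 ≤ r) {m : ℝ × ℝ × ℝ}
    (h : ∀ x, pw m x = dist x o ^ 2 - r ^ 2) (x : Plane) :
    (x ∈ Metric.sphere o r ↔ pw m x = 0) ∧ (x ∈ Metric.ball o r ↔ pw m x < 0) ∧
      (x ∉ Metric.closedBall o r ↔ 0 < pw m x) := by
  rw [h, Metric.mem_sphere, Metric.mem_ball, Metric.mem_closedBall, not_le, sub_eq_zero, sub_neg,
    sub_pos]
  exact ⟨(sq_eq_sq₀ dist_nonneg hr).symm, (sq_lt_sq₀ dist_nonneg hr).symm,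
    (sq_lt_sq₀ hr dist_nonneg).symm⟩

theorem outsideCircumdisk_iff {p q r z : Plane} :
    OutsideCircumdisk p q r z ↔ ∃ m, pw m p = 0 ∧ pw m q = 0 ∧ pw m r = 0 ∧ 0 < pw m z := by
  constructor
  · rintro ⟨o, ρ, hs, hz⟩
    have hρ : 0 ≤ ρ := by
      have := hs (Set.mem_insert p _)
      rw [Metric.mem_sphere] at this
      rw [← this]; exact dist_nonneg
    obtain ⟨m, hm⟩ := exists_pw_eq o ρ
    have key := sphere_iff_pw hρ hm
    exact ⟨m, (key p).1.mp (hs (by simp)), (key q).1.mp (hs (by simp)), (key r).1.mp (hs (by simp)),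
      (key z).2.2.mp hz⟩
  · rintro ⟨m, hp, hq, hr, hz⟩
    obtain ⟨o, ρ, hρ, hm⟩ := exists_center hp
    have key := sphere_iff_pw hρ hm
    refine ⟨o, ρ, ?_, (key z).2.2.mpr hz⟩
    rintro x (rfl | rfl | rfl)
    · exact (key _).1.mpr hp
    · exact (key _).1.mpr hq
    · exact (key _).1.mpr hr

/-- The point `p` lies in an open disk that inscribes `t`. -/
def InDisk (t : Set Plane) (p : Plane) : Prop := ∃ m, (∀ q ∈ t, pw m q = 0) ∧ pw m p < 0

theorem inDisk_triple {a b c p : Plane} :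
    InDisk {a, b, c} p ↔ ∃ m, pw m a = 0 ∧ pw m b = 0 ∧ pw m c = 0 ∧ pw m p < 0 := by
  simp [InDisk, and_assoc]

theorem inDisk_triple_iff {a b c p : Plane} (h : cr a b c ≠ 0) {m : ℝ × ℝ × ℝ} (ha : pw m a = 0)
    (hb : pw m b = 0) (hc : pw m c = 0) : InDisk {a, b, c} p ↔ pw m p < 0 := by
  rw [inDisk_triple]
  constructor
  · rintro ⟨n, ha', hb', hc', hp⟩
    rwa [circle_unique h (ha.trans ha'.symm) (hb.trans hb'.symm) (hc.trans hc'.symm)]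
  · intro hp
    exact ⟨m, ha, hb, hc, hp⟩

/-! ### Crossing segments -/

/-- The open segments `ab` and `cd` meet. -/
def Crossing (a b c d : Plane) : Prop :=
  ∃ s t : ℝ, 0 < s ∧ s < 1 ∧ 0 < t ∧ t < 1 ∧
    (1 - s) * a 0 + s * b 0 = (1 - t) * c 0 + t * d 0 ∧
    (1 - s) * a 1 + s * b 1 = (1 - t) * c 1 + t * d 1

theorem Crossing.symm {a b c d : Plane} (h : Crossing a b c d) : Crossing c d a b := by
  obtain ⟨s, t, h1, h2, h3, h4, e0, e1⟩ := h
  exact ⟨t, s, h3, h4, h1, h2, e0.symm, e1.symm⟩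

theorem Crossing.swap_left {a b c d : Plane} (h : Crossing a b c d) : Crossing b a c d := by
  obtain ⟨s, t, h1, h2, h3, h4, e0, e1⟩ := h
  exact ⟨1 - s, t, by linarith, by linarith, h3, h4, by linarith, by linarith⟩

theorem Crossing.swap_right {a b c d : Plane} (h : Crossing a b c d) : Crossing a b d c :=
  h.symm.swap_left.symm

theorem cr_rotate (a b c : Plane) : cr b c a = cr a b c := by unfold cr; ring

theorem cr_swap (a b c : Plane) : cr b a c = -cr a b c := by unfold cr; ring

theorem cr_self_right (a b : Plane) : cr a b b = 0 := by unfold cr; ring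

theorem cr_self_left (a b : Plane) : cr a b a = 0 := by unfold cr; ring

theorem cr_barycentric (p q : Plane) {a b c x : Plane} {α β γ : ℝ} (h : α + β + γ = 1)
    (h0 : x 0 = α * a 0 + β * b 0 + γ * c 0) (h1 : x 1 = α * a 1 + β * b 1 + γ * c 1) :
    cr p q x = α * cr p q a + β * cr p q b + γ * cr p q c := by
  unfold cr
  rw [h0, h1]
  linear_combination (p 1 * q 0 - p 0 * q 1) * h

/-- Only `t` is controlled: the line `ab` cuts the open segment `cd`, possibly outside the segment
`ab`. Locating `s` requires information on circles. -/
theorem exists_line_meet {a b c d : Plane} (h : cr a b c * cr a b d < 0) :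
    ∃ s t : ℝ, 0 < t ∧ t < 1 ∧
    (1 - s) * a 0 + s * b 0 = (1 - t) * c 0 + t * d 0 ∧
    (1 - s) * a 1 + s * b 1 = (1 - t) * c 1 + t * d 1 := by
  have hne : cr a b c - cr a b d ≠ 0 := by
    intro e
    rw [sub_eq_zero.mp e] at h
    exact absurd h (not_lt.mpr (mul_self_nonneg _))
  refine ⟨- cr c d a / (cr a b c - cr a b d), cr a b c / (cr a b c - cr a b d), ?_, ?_, ?_, ?_⟩
  · rcases mul_neg_iff.mp h with ⟨h1, h2⟩ | ⟨h1, h2⟩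
    · apply div_pos <;> linarith
    · apply div_pos_of_neg_of_neg <;> linarith
  · rcases mul_neg_iff.mp h with ⟨h1, h2⟩ | ⟨h1, h2⟩
    · rw [div_lt_one] <;> linarith
    · rw [div_lt_one_of_neg] <;> linarith
  all_goals
    field_simp
    unfold cr
    ring

/-- Signed area is affine along each segment and vanishes at the crossing point, an interior point
of both. The hypothesis excludes four collinear points. -/
theorem Crossing.sides {a b c d : Plane} (h : Crossing a b c d) (hc : cr a b c ≠ 0) :
    cr a b c * cr a b d < 0 ∧ cr c d a * cr c d b < 0 := by
  obtain ⟨s, t, s0, s1, t0, t1, e0, e1⟩ := h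
  have k1 : (1 - t) * cr a b c + t * cr a b d = 0 := by
    unfold cr
    linear_combination (b 1 - a 1) * e0 - (b 0 - a 0) * e1
  have k2 : (1 - s) * cr c d a + s * cr c d b = 0 := by
    unfold cr
    linear_combination (d 0 - c 0) * e1 - (d 1 - c 1) * e0
  have k3 : t * cr c d a = -s * cr a b c := by
    unfold cr
    linear_combination (c 1 - a 1) * e0 - (c 0 - a 0) * e1
  have hd : t * (cr a b c * cr a b d) = - ((1 - t) * cr a b c ^ 2) := by
    linear_combination cr a b c * k1
  have ha : cr c d a ≠ 0 := by
    intro h0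
    rw [h0, mul_zero] at k3
    have := mul_ne_zero (neg_ne_zero.mpr s0.ne') hc
    exact this k3.symm
  have hb : s * (cr c d a * cr c d b) = - ((1 - s) * cr c d a ^ 2) := by
    linear_combination cr c d a * k2
  constructor
  · have : 0 < (1 - t) * cr a b c ^ 2 := mul_pos (by linarith) (by positivity)
    nlinarith
  · have : 0 < (1 - s) * cr c d a ^ 2 := mul_pos (by linarith) (by positivity)
    nlinarith

/-- The powers at the endpoints of two crossing segments. -/
theorem pw_cross (m n : ℝ × ℝ × ℝ) {a b c d : Plane} {s t : ℝ}
    (e0 : (1 - s) * a 0 + s * b 0 = (1 - t) * c 0 + t * d 0)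
    (e1 : (1 - s) * a 1 + s * b 1 = (1 - t) * c 1 + t * d 1) :
    (1 - t) * pw m c + t * pw m d - (1 - s) * pw m a - s * pw m b =
      (1 - t) * pw n c + t * pw n d - (1 - s) * pw n a - s * pw n b := by
  unfold pw
  linear_combination (m.1 - n.1) * e0 + (m.2.1 - n.2.1) * e1

/-- By convexity, the point where `cd` meets the line `ab` has negative power. On that line the
power is `-s(1-s)|ab|²`, so the point lies strictly between `a` and `b`. -/
theorem crossing_of_inDisk {a b c d : Plane} (h : cr a b c * cr a b d < 0) {m : ℝ × ℝ × ℝ}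
    (ha : pw m a = 0) (hb : pw m b = 0) (hc : pw m c = 0) (hd : pw m d < 0) :
    Crossing a b c d := by
  obtain ⟨s, t, t0, t1, e0, e1⟩ := exists_line_meet h
  suffices 0 < s * (1 - s) by
    have s0 : 0 < s := by
      by_contra hs
      nlinarith
    exact ⟨s, t, s0, by nlinarith, t0, t1, e0, e1⟩
  have key : t * pw m d - t * (1 - t) * dist c d ^ 2 = - (s * (1 - s)) * dist a b ^ 2 := by
    have h1 := pw_barycentric m (a := a) (b := b) (c := b)
      (x := !₂[(1 - s) * a 0 + s * b 0, (1 - s) * a 1 + s * b 1])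
      (α := 1 - s) (β := s) (γ := 0) (by ring) (by simp) (by simp)
    have h2 := pw_barycentric m (a := c) (b := d) (c := d)
      (x := !₂[(1 - s) * a 0 + s * b 0, (1 - s) * a 1 + s * b 1])
      (α := 1 - t) (β := t) (γ := 0) (by ring) (by simp [e0]) (by simp [e1])
    rw [h1, ha, hb, hc] at h2
    linarith
  have h3 : t * pw m d < 0 := mul_neg_of_pos_of_neg t0 hd
  have h4 : 0 ≤ t * (1 - t) * dist c d ^ 2 :=
    mul_nonneg (mul_nonneg t0.le (by linarith)) (sq_nonneg _)
  by_contra h5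
  nlinarith [sq_nonneg (dist a b)]

/-- If `s ≤ 0`, then `a` is a convex combination of `c`, `d`, `b` and so lies in their closed
circumdisk; if `s ≥ 1`, the same holds for `b` with respect to `c`, `d`, `a`. -/
theorem crossing_of_outside {a b c d : Plane} (h : cr a b c * cr a b d < 0)
    {m n : ℝ × ℝ × ℝ} (hc : pw m c = 0) (hd : pw m d = 0) (hb : pw m b = 0) (ha : 0 < pw m a)
    (hc' : pw n c = 0) (hd' : pw n d = 0) (ha' : pw n a = 0) (hb' : 0 < pw n b) :
    Crossing a b c d := by
  obtain ⟨s, t, t0, t1, e0, e1⟩ := exists_line_meet h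
  refine ⟨s, t, ?_, ?_, t0, t1, e0, e1⟩
  · by_contra hs
    push Not at hs
    have hp : 0 < 1 - s := by linarith
    have := pw_le_of_barycentric m (x := a) (a := c) (b := d) (c := b) (α := (1 - t) / (1 - s))
      (β := t / (1 - s)) (γ := -s / (1 - s)) (by field_simp; ring)
      (div_nonneg (by linarith) hp.le) (by positivity) (div_nonneg (by linarith) hp.le)
      (by field_simp; linarith) (by field_simp; linarith)
    rw [hc, hd, hb] at this
    linarith
  · by_contra hs
    push Not at hs
    have hp : 0 < s := by linarith
    have := pw_le_of_barycentric n (x := b) (a := c) (b := d) (c := a) (α := (1 - t) / s)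
      (β := t / s) (γ := (s - 1) / s) (by field_simp; ring)
      (div_nonneg (by linarith) hp.le) (by positivity) (div_nonneg (by linarith) hp.le)
      (by field_simp; linarith) (by field_simp; linarith)
    rw [hc', hd', ha'] at this
    linarith

/-! ### The four circumcircles of a convex quadrilateral -/

/-- The four circles through three of the endpoints of two crossing segments, where `d` lies
inside the first one. -/
structure DiskConfig (a b c d : Plane) (f₁ f₂ g₁ g₂ : ℝ × ℝ × ℝ) : Prop where
  crossing : Crossing a b c d
  noncol : cr a b c ≠ 0
  f₁a : pw f₁ a = 0
  f₁b : pw f₁ b = 0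
  f₁c : pw f₁ c = 0
  f₁d : pw f₁ d < 0
  f₂a : pw f₂ a = 0
  f₂b : pw f₂ b = 0
  f₂c : pw f₂ c < 0
  f₂d : pw f₂ d = 0
  g₁a : 0 < pw g₁ a
  g₁b : pw g₁ b = 0
  g₁c : pw g₁ c = 0
  g₁d : pw g₁ d = 0
  g₂a : pw g₂ a = 0
  g₂b : 0 < pw g₂ b
  g₂c : pw g₂ c = 0
  g₂d : pw g₂ d = 0

/-- The combination in `pw_cross` does not depend on the circle. Comparing `f` with `g` leaves `t *
pw f d = -(1 - s) * pw g a`. -/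
theorem Crossing.inDisk_iff_outside {a b c d : Plane} (h : Crossing a b c d)
    {f g : ℝ × ℝ × ℝ} (fa : pw f a = 0) (fb : pw f b = 0) (fc : pw f c = 0)
    (gb : pw g b = 0) (gc : pw g c = 0) (gd : pw g d = 0) : pw f d < 0 ↔ 0 < pw g a := by
  obtain ⟨s, t, s0, s1, t0, t1, e0, e1⟩ := h
  have := pw_cross f g e0 e1
  rw [fa, fb, fc, gb, gc, gd] at this
  constructor
  · intro h
    apply (mul_pos_iff_of_pos_left (sub_pos.mpr s1)).mp
    nlinarith
  · intro h
    rw [← neg_pos]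
    apply (mul_pos_iff_of_pos_left t0).mp
    nlinarith

theorem Crossing.noncol {a b c d : Plane} (h : Crossing a b c d) (hc : cr a b c ≠ 0) :
    cr a b d ≠ 0 ∧ cr c d b ≠ 0 ∧ cr c d a ≠ 0 := by
  obtain ⟨h1, h2⟩ := h.sides hc
  exact ⟨right_ne_zero_of_mul h1.ne, right_ne_zero_of_mul h2.ne, left_ne_zero_of_mul h2.ne⟩

/-- Applying `Crossing.inDisk_iff_outside` to the relabelled quadrilaterals makes the four sign
conditions equivalent, so one of them gives them all. -/
theorem exists_diskConfig {a b c d : Plane} (h : Crossing a b c d) (hc : cr a b c ≠ 0) :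
    ∃ f₁ f₂ g₁ g₂, (pw f₁ a = 0 ∧ pw f₁ b = 0 ∧ pw f₁ c = 0) ∧
      (pw g₁ c = 0 ∧ pw g₁ d = 0 ∧ pw g₁ b = 0) ∧
      ((pw f₁ d < 0 ∨ 0 < pw g₁ a) → DiskConfig a b c d f₁ f₂ g₁ g₂) := by
  obtain ⟨n1, n2, n3⟩ := h.noncol hc
  obtain ⟨f₁, f1a, f1b, f1c⟩ := exists_circle hc
  obtain ⟨f₂, f2a, f2b, f2d⟩ := exists_circle n1
  obtain ⟨g₁, g1c, g1d, g1b⟩ := exists_circle n2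
  obtain ⟨g₂, g2c, g2d, g2a⟩ := exists_circle n3
  refine ⟨f₁, f₂, g₁, g₂, ⟨f1a, f1b, f1c⟩, ⟨g1c, g1d, g1b⟩, fun hlt => ?_⟩
  have i1 := h.inDisk_iff_outside f1a f1b f1c g1b g1c g1d
  have i2 := h.swap_left.inDisk_iff_outside f1b f1a f1c g2a g2c g2d
  have i3 := h.swap_right.inDisk_iff_outside f2a f2b f2d g1b g1d g1c
  have j1 : pw f₁ d < 0 := by
    rcases hlt with h | h
    · exact h
    · exact i1.mpr h
  have j2 := i1.mp j1
  exact ⟨h, hc, f1a, f1b, f1c, j1, f2a, f2b, i3.mpr j2, f2d, j2, g1b, g1c, g1d, g2a,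
    i2.mp j1, g2c, g2d⟩

section Quadrilateral

variable {a b c d : Plane} {f₁ f₂ g₁ g₂ : ℝ × ℝ × ℝ}

theorem DiskConfig.swap_left (h : DiskConfig a b c d f₁ f₂ g₁ g₂) :
    DiskConfig b a c d f₁ f₂ g₂ g₁ :=
  ⟨h.crossing.swap_left, by rw [cr_swap]; exact neg_ne_zero.mpr h.noncol, h.f₁b, h.f₁a, h.f₁c,
    h.f₁d, h.f₂b, h.f₂a, h.f₂c, h.f₂d, h.g₂b, h.g₂a, h.g₂c, h.g₂d, h.g₁b, h.g₁a, h.g₁c, h.g₁d⟩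

theorem DiskConfig.swap_right (h : DiskConfig a b c d f₁ f₂ g₁ g₂) :
    DiskConfig a b d c f₂ f₁ g₁ g₂ :=
  ⟨h.crossing.swap_right, (h.crossing.noncol h.noncol).1, h.f₂a, h.f₂b, h.f₂d,
    h.f₂c, h.f₁a, h.f₁b, h.f₁d, h.f₁c, h.g₁a, h.g₁b, h.g₁d, h.g₁c, h.g₂a, h.g₂b, h.g₂d, h.g₂c⟩

theorem DiskConfig.union_aux (h : DiskConfig a b c d f₁ f₂ g₁ g₂) {x : Plane}
    (hx : pw g₁ x < 0) : pw f₁ x < 0 ∨ pw f₂ x < 0 := by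
  by_contra hcon
  push Not at hcon
  obtain ⟨h1, h2⟩ := hcon
  obtain ⟨α, β, γ, hs, e0, e1⟩ := exists_barycentric (h.crossing.noncol h.noncol).2.1 x
  have k1 := pw_sub_barycentric g₁ f₁ hs e0 e1
  have k2 := pw_sub_barycentric g₁ f₂ hs e0 e1
  rw [h.g₁b, h.g₁c, h.g₁d, h.f₁b, h.f₁c] at k1
  rw [h.g₁b, h.g₁c, h.g₁d, h.f₂b, h.f₂d] at k2
  -- Outside both old disks, the affine differences force the weights of `c` and `d` to be negative.
  -- Then `b` is a convex combination of `x`, `c`, `d`, hence strictly inside its own circle.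
  have hβ : β < 0 := by nlinarith [h.f₁d]
  have hα : α < 0 := by nlinarith [h.f₂c]
  have hγ : 0 < γ := by linarith
  have := pw_le_of_barycentric g₁ (x := b) (a := x) (b := c) (c := d) (α := 1 / γ)
    (β := -α / γ) (γ := -β / γ) (by field_simp; linarith) (by positivity)
    (div_nonneg (by linarith) hγ.le) (div_nonneg (by linarith) hγ.le)
    (by field_simp; linarith) (by field_simp; linarith)
  rw [h.g₁b, h.g₁c, h.g₁d] at this
  have : 1 / γ * pw g₁ x < 0 := mul_neg_of_pos_of_neg (by positivity) hx
  linarith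

theorem DiskConfig.union (h : DiskConfig a b c d f₁ f₂ g₁ g₂) {x : Plane}
    (hx : pw g₁ x < 0 ∨ pw g₂ x < 0) : pw f₁ x < 0 ∨ pw f₂ x < 0 := by
  rcases hx with hx | hx
  · exact h.union_aux hx
  · exact h.swap_left.union_aux hx

theorem DiskConfig.inter_aux₂ (h : DiskConfig a b c d f₁ f₂ g₁ g₂) {s t α β γ : ℝ} {x : Plane}
    (hs : s < 1) (ht0 : 0 < t) (ht1 : t < 1)
    (e0 : (1 - s) * a 0 + s * b 0 = (1 - t) * c 0 + t * d 0)
    (e1 : (1 - s) * a 1 + s * b 1 = (1 - t) * c 1 + t * d 1)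
    (hα : α < 0) (hβ : β < 0) (hsum : α + β + γ = 1)
    (x0 : x 0 = α * a 0 + β * b 0 + γ * c 0) (x1 : x 1 = α * a 1 + β * b 1 + γ * c 1)
    (hx : pw g₁ x < 0) (hst : 0 ≤ α * s - β * (1 - s)) : False := by
  -- the ray from `x` through `c` hits `ab` at a point of the segment from the crossing to `b`
  have hγ : 0 < γ := by linarith
  set p : Plane := !₂[(1 - s) * a 0 + s * b 0, (1 - s) * a 1 + s * b 1] with hp
  have p0 : p 0 = (1 - s) * a 0 + s * b 0 := by simp [hp]
  have p1 : p 1 = (1 - s) * a 1 + s * b 1 := by simp [hp]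
  have hs' : 0 < 1 - s := by linarith
  have pp := pw_le_of_barycentric g₁ (x := p) (a := c) (b := d) (c := d) (α := 1 - t) (β := t)
    (γ := 0) (by ring) (by linarith) ht0.le le_rfl (by rw [p0, e0]; ring) (by rw [p1, e1]; ring)
  rw [h.g₁c, h.g₁d] at pp
  have key := pw_le_of_barycentric g₁ (x := c) (a := x) (b := p) (c := b) (α := 1 / γ)
    (β := -α / (γ * (1 - s))) (γ := (α * s - β * (1 - s)) / (γ * (1 - s)))
    (by field_simp; linear_combination -(1 - s) * hsum) (by positivity)
    (div_nonneg (by linarith) (by positivity)) (by positivity)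
    (by rw [x0, p0]; field_simp; ring) (by rw [x1, p1]; field_simp; ring)
  rw [h.g₁c, h.g₁b] at key
  have k1 : 1 / γ * pw g₁ x < 0 := mul_neg_of_pos_of_neg (by positivity) hx
  have k2 : 0 ≤ -α / (γ * (1 - s)) := div_nonneg (by linarith) (by positivity)
  nlinarith

theorem DiskConfig.inter_aux (h : DiskConfig a b c d f₁ f₂ g₁ g₂) {x : Plane}
    (hx₁ : pw g₁ x < 0) (hx₂ : pw g₂ x < 0) : pw f₁ x < 0 := by
  by_contra h1
  push Not at h1
  obtain ⟨α, β, γ, hsum, x0, x1⟩ := exists_barycentric h.noncol x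
  have k1 := pw_sub_barycentric g₁ f₁ hsum x0 x1
  have k2 := pw_sub_barycentric g₂ f₁ hsum x0 x1
  rw [h.g₁b, h.g₁c, h.f₁a, h.f₁b, h.f₁c] at k1
  rw [h.g₂a, h.g₂c, h.f₁a, h.f₁b, h.f₁c] at k2
  -- Thus `x` lies in the cone at `c` opposite to the triangle `abc`. The two cases below say on
  -- which side of the crossing point the ray from `x` through `c` meets `ab`.
  have hα : α < 0 := by nlinarith [h.g₁a]
  have hβ : β < 0 := by nlinarith [h.g₂b]
  obtain ⟨s, t, s0, s1, t0, t1, e0, e1⟩ := h.crossing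
  rcases le_total 0 (α * s - β * (1 - s)) with hst | hst
  · exact h.inter_aux₂ s1 t0 t1 e0 e1 hα hβ hsum x0 x1 hx₁ hst
  · exact h.swap_left.inter_aux₂ (s := 1 - s) (γ := γ) (by linarith) t0 t1 (by linarith) (by linarith)
      hβ hα (by linarith) (by linarith) (by linarith) hx₂ (by linarith)

theorem DiskConfig.inter (h : DiskConfig a b c d f₁ f₂ g₁ g₂) {x : Plane}
    (hx₁ : pw g₁ x < 0) (hx₂ : pw g₂ x < 0) : pw f₁ x < 0 ∧ pw f₂ x < 0 :=
  ⟨h.inter_aux hx₁ hx₂, h.swap_right.inter_aux hx₁ hx₂⟩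

/-- Replacing a diagonal preserves the region covered. -/
theorem Crossing.hull_subset (h : Crossing a b c d) :
    convexHull ℝ {a, b, c} ⊆ convexHull ℝ {c, d, b} ∪ convexHull ℝ {d, c, a} := by
  obtain ⟨s, t, s0, s1, t0, t1, e0, e1⟩ := h
  intro x hx
  obtain ⟨α, β, γ, hα, hβ, hγ, hsum, x0, x1⟩ := mem_hull_triple.mp hx
  have hs' : 0 < 1 - s := by linarith
  have ht' : 0 < 1 - t := by linarith
  -- The crossing point splits `abc` in two: trade all the weight of `a` (or of `b`) for weight at
  -- the crossing point, then write that point in terms of `c` and `d`.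
  rcases le_total (α * s) (β * (1 - s)) with hst | hst
  · left
    rw [mem_hull_triple]
    refine ⟨α / (1 - s) * (1 - t) + γ, α / (1 - s) * t, (β * (1 - s) - α * s) / (1 - s),
      by positivity, by positivity, div_nonneg (by linarith) hs'.le, ?_, ?_, ?_⟩
    · field_simp; linear_combination (1 - s) * hsum
    · field_simp; rw [x0]; linear_combination α * e0
    · field_simp; rw [x1]; linear_combination α * e1
  · right
    rw [mem_hull_triple]
    refine ⟨β / s * t, β / s * (1 - t) + γ, (α * s - β * (1 - s)) / s,
      by positivity, by positivity, div_nonneg (by linarith) s0.le, ?_, ?_, ?_⟩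
    · field_simp; linear_combination s * hsum
    · field_simp; rw [x0]; linear_combination β * e0
    · field_simp; rw [x1]; linear_combination β * e1

/-- A part of the old triangle `abc` that contains at most one end of the diagonal `ab` meets the
new triangle `cdb` in a common face. -/
theorem hull_inter_subset (h : cr c d a * cr c d b < 0) {e : Set Plane} (he : e ⊆ {a, b, c})
    (hab : ¬ (a ∈ e ∧ b ∈ e)) :
    convexHull ℝ e ∩ convexHull ℝ {c, d, b} ⊆ convexHull ℝ (e ∩ {c, d, b}) := by
  rintro x ⟨hx, hx'⟩
  by_cases ha : a ∈ e
  · have hb : b ∉ e := fun hb => hab ⟨ha, hb⟩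
    have he' : e ⊆ {a, c} := by
      intro y hy
      rcases he hy with rfl | rfl | rfl
      · simp
      · exact absurd hy hb
      · simp
    obtain ⟨α, β, hα, hβ, hs, x0, x1⟩ := mem_hull_pair.mp (convexHull_mono he' hx)
    obtain ⟨α', β', γ', hα', hβ', hγ', hs', x0', x1'⟩ := mem_hull_triple.mp hx'
    have k1 := cr_barycentric c d (a := a) (b := c) (c := c) (x := x) (α := α) (β := β) (γ := 0)
      (by linarith) (by linarith) (by linarith)
    have k2 := cr_barycentric c d hs' x0' x1'
    rw [cr_self_left] at k1
    rw [cr_self_left, cr_self_right] at k2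
    have hα0 : α = 0 := by
      have : α * cr c d a ^ 2 = γ' * (cr c d a * cr c d b) := by
        linear_combination cr c d a * (k2 - k1)
      have h2 : 0 < cr c d a ^ 2 := by
        have := left_ne_zero_of_mul h.ne
        positivity
      by_contra h0
      have h3 : 0 < α := lt_of_le_of_ne hα (Ne.symm h0)
      have h4 : 0 < α * cr c d a ^ 2 := by positivity
      nlinarith
    have hxc : x = c := by
      subst hα0
      have : β = 1 := by linarith
      subst this
      exact plane_ext (by linarith) (by linarith)
    by_cases hc : c ∈ e
    · exact subset_convexHull ℝ _ ⟨hxc ▸ hc, by simp [hxc]⟩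
    · exfalso
      have : e ⊆ {a} := by
        intro y hy
        rcases he' hy with rfl | rfl
        · rfl
        · exact absurd hy hc
      have hxa := convexHull_mono (𝕜 := ℝ) this hx
      rw [convexHull_singleton, Set.mem_singleton_iff] at hxa
      rw [← hxa, hxc, cr_self_left] at h
      simp at h
  · have : e ∩ {c, d, b} = e := by
      apply Set.inter_eq_left.mpr
      intro y hy
      rcases he hy with rfl | rfl | rfl
      · exact absurd hy ha
      · simp
      · simp
    rw [this]
    exact hx

theorem hull_new_inter (h : cr c d a * cr c d b < 0) :
    convexHull ℝ {c, d, b} ∩ convexHull ℝ {d, c, a} ⊆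
      convexHull ℝ (({c, d, b} : Set Plane) ∩ {d, c, a}) := by
  rintro x ⟨hx, hx'⟩
  obtain ⟨α, β, γ, hα, hβ, hγ, hs, x0, x1⟩ := mem_hull_triple.mp hx
  obtain ⟨α', β', γ', hα', hβ', hγ', hs', x0', x1'⟩ := mem_hull_triple.mp hx'
  have k1 := cr_barycentric c d hs x0 x1
  have k2 := cr_barycentric c d hs' x0' x1'
  rw [cr_self_left, cr_self_right] at k1 k2
  have hγ0 : γ = 0 := by
    have : γ * cr c d b ^ 2 = γ' * (cr c d a * cr c d b) := by
      linear_combination cr c d b * (k2 - k1)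
    have h2 : 0 < cr c d b ^ 2 := by
      have := right_ne_zero_of_mul h.ne
      positivity
    by_contra h0
    have h3 : 0 < γ := lt_of_le_of_ne hγ (Ne.symm h0)
    have h4 : 0 < γ * cr c d b ^ 2 := by positivity
    nlinarith
  subst hγ0
  have : x ∈ convexHull ℝ {c, d} :=
    mem_hull_pair.mpr ⟨α, β, hα, hβ, by linarith, by linarith, by linarith⟩
  refine convexHull_mono ?_ this
  rintro y (rfl | rfl) <;> simp

end Quadrilateral

/-! ### Vertices and faces of a triangle -/

section Triangle

theorem IsTriangle.exists_eq_insert {t : Set Plane} (h : IsTriangle t) {p : Plane} (hp : p ∈ t) :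
    ∃ q r, t = {p, q, r} ∧ cr p q r ≠ 0 := by
  suffices ∃ q r, t = {p, q, r} by
    obtain ⟨q, r, e⟩ := this
    exact ⟨q, r, e, isTriangle_triple_iff.mp (e ▸ h)⟩
  obtain ⟨a, b, c, -, e⟩ := h.exists_cr
  subst e
  rcases hp with rfl | rfl | rfl
  · exact ⟨b, c, rfl⟩
  · exact ⟨a, c, Set.insert_comm _ _ _⟩
  · exact ⟨a, b, by rw [Set.pair_comm b, Set.insert_comm]⟩

theorem IsTriangle.exists_eq_insert_insert {t : Set Plane} (h : IsTriangle t) {p q : Plane}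
    (hp : p ∈ t) (hq : q ∈ t) (hpq : p ≠ q) : ∃ r, t = {p, q, r} ∧ cr p q r ≠ 0 := by
  obtain ⟨q', r', rfl, hcr⟩ := h.exists_eq_insert hp
  rcases hq with rfl | rfl | rfl
  · exact absurd rfl hpq
  · exact ⟨r', rfl, hcr⟩
  · refine ⟨q', by rw [Set.pair_comm], ?_⟩
    unfold cr at *
    intro h0
    apply hcr
    linarith

theorem ne_of_cr_ne_zero {a b c : Plane} (h : cr a b c ≠ 0) : a ≠ b ∧ a ≠ c ∧ b ≠ c := by
  refine ⟨?_, ?_, ?_⟩ <;> rintro rfl <;> apply h <;> unfold cr <;> ring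

/-- Without `a`, the face `e` lies on the line `bc`. In the contrapositive direction, a point of a
common face lying off that line shows that `a` is shared. -/
theorem notMem_hull_of_notMem {a b c : Plane} (h : cr a b c ≠ 0) {e : Set Plane}
    (he : e ⊆ {a, b, c}) (ha : a ∉ e) {x : Plane} (hx : cr b c x ≠ 0) : x ∉ convexHull ℝ e := by
  intro hmem
  have he' : e ⊆ {b, c} := by
    intro y hy
    rcases he hy with rfl | rfl | rfl
    · exact absurd hy ha
    · simp
    · simp
  obtain ⟨α, β, -, -, hs, h0, h1⟩ := mem_hull_pair.mp (convexHull_mono he' hmem)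
  have := cr_barycentric b c (a := b) (b := c) (c := c) (x := x) (α := α) (β := β) (γ := 0)
    (by linarith) (by linarith) (by linarith)
  rw [cr_self_left, cr_self_right] at this
  exact hx (by linarith)

end Triangle

/-! ### Lattice translations of triangles -/

section Translation

variable {L : Submodule ℤ Plane} {T : Set (TorusFace L)}

theorem projFace_eq_iff {s t : Set Plane} :
    projFace L s = projFace L t ↔ ∃ v : L, v +ᵥ t = s := by
  unfold projFace
  rw [Quotient.eq]
  exact Iff.rfl

theorem projFace_vadd (v : L) (t : Set Plane) : projFace L (v +ᵥ t) = projFace L t :=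
  projFace_eq_iff.mpr ⟨v, rfl⟩

theorem vadd_mem_lifts {v : L} {t : Set Plane} : v +ᵥ t ∈ lifts L T ↔ t ∈ lifts L T := by
  unfold lifts
  rw [Set.mem_ofPred_eq, Set.mem_ofPred_eq, projFace_vadd]

theorem vadd_triple (v : L) (a b c : Plane) :
    v +ᵥ ({a, b, c} : Set Plane) = {v +ᵥ a, v +ᵥ b, v +ᵥ c} := by
  simp [Set.vadd_set_insert]

theorem vadd_coord (v : L) (a : Plane) (i : Fin 2) : (v +ᵥ a) i = (v : Plane) i + a i := rfl

theorem cr_vadd (v : L) (a b c : Plane) : cr (v +ᵥ a) (v +ᵥ b) (v +ᵥ c) = cr a b c := by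
  unfold cr
  simp only [vadd_coord]
  ring

theorem inDisk_vadd_of {t : Set Plane} {p : Plane} (v : L) (h : InDisk t p) :
    InDisk (v +ᵥ t) (v +ᵥ p) := by
  obtain ⟨m, ht, hp⟩ := h
  let u := (v : Plane)
  have key : ∀ x : Plane, pw (m.1 + 2 * u 0, m.2.1 + 2 * u 1,
      m.2.2 - m.1 * u 0 - m.2.1 * u 1 - u 0 ^ 2 - u 1 ^ 2) (v +ᵥ x) = pw m x := by
    intro x
    unfold pw
    simp only [vadd_coord, u]
    ring
  refine ⟨_, ?_, (key p).trans_lt hp⟩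
  rintro _ ⟨q, hq, rfl⟩
  exact (key q).trans (ht q hq)

theorem inDisk_vadd_iff {t : Set Plane} {p : Plane} (v : L) :
    InDisk (v +ᵥ t) (v +ᵥ p) ↔ InDisk t p := by
  refine ⟨fun h => ?_, inDisk_vadd_of v⟩
  simpa using inDisk_vadd_of (-v) h

/-- The translation is parallel to `ab`: the images of `a` and `b` are at the same signed height
over `ab`, and they cannot both be `d`. -/
theorem cr_eq_zero_of_vadd {v : L} {a b d : Plane} (hab : a ≠ b)
    (ha : v +ᵥ a ∈ ({a, b, d} : Set Plane)) (hb : v +ᵥ b ∈ ({a, b, d} : Set Plane)) :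
    cr a b (v +ᵥ a) = 0 := by
  rcases ha with h | h | h
  · rw [h, cr_self_left]
  · rw [h, cr_self_right]
  · have e : cr a b (v +ᵥ a) = cr a b (v +ᵥ b) := by
      unfold cr
      simp only [vadd_coord]
      ring
    rcases hb with h' | h' | h'
    · rw [e, h', cr_self_left]
    · rw [e, h', cr_self_right]
    · exact absurd (vadd_left_cancel v (h.trans h'.symm)) hab

theorem eq_zero_of_vadd_triple {v : L} {a b c : Plane} (h : cr a b c ≠ 0)
    (hv : v +ᵥ ({a, b, c} : Set Plane) = {a, b, c}) : v = 0 := by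
  obtain ⟨h1, h2, h3⟩ := ne_of_cr_ne_zero h
  rw [vadd_triple] at hv
  have ha : v +ᵥ a ∈ ({a, b, c} : Set Plane) := hv ▸ (by simp)
  have hb : v +ᵥ b ∈ ({a, b, c} : Set Plane) := hv ▸ (by simp)
  have hc : v +ᵥ c ∈ ({a, b, c} : Set Plane) := hv ▸ (by simp)
  have k1 := cr_eq_zero_of_vadd h1 ha hb
  rw [Set.pair_comm] at ha hc
  have k2 := cr_eq_zero_of_vadd h2 ha hc
  unfold cr at *
  simp only [vadd_coord] at k1 k2
  apply Subtype.ext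
  apply plane_ext
  · apply (mul_eq_zero.mp (?_ : ((b 0 - a 0) * (c 1 - a 1) - (b 1 - a 1) * (c 0 - a 0)) *
      (v : Plane) 0 = 0)).resolve_left h
    linear_combination (c 0 - a 0) * k1 - (b 0 - a 0) * k2
  · apply (mul_eq_zero.mp (?_ : ((b 0 - a 0) * (c 1 - a 1) - (b 1 - a 1) * (c 0 - a 0)) *
      (v : Plane) 1 = 0)).resolve_left h
    linear_combination (c 1 - a 1) * k1 - (b 1 - a 1) * k2

/-- Such a translation would be parallel to `ab`, so it would keep `c` on its own side of that line.
Hence the two triangles at an edge are different faces on the torus. -/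
theorem vadd_triple_ne {v : L} {a b c d : Plane} (h : cr a b c * cr a b d < 0) :
    v +ᵥ ({a, b, c} : Set Plane) ≠ {a, b, d} := by
  intro hv
  obtain ⟨h1, -, -⟩ := ne_of_cr_ne_zero (left_ne_zero_of_mul h.ne)
  rw [vadd_triple] at hv
  have ha : v +ᵥ a ∈ ({a, b, d} : Set Plane) := hv ▸ (by simp)
  have hb : v +ᵥ b ∈ ({a, b, d} : Set Plane) := hv ▸ (by simp)
  have hc : v +ᵥ c ∈ ({a, b, d} : Set Plane) := hv ▸ (by simp)
  have k1 := cr_eq_zero_of_vadd h1 ha hb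
  have k2 : cr a b (v +ᵥ c) = cr a b c := by
    unfold cr at *
    simp only [vadd_coord] at *
    linear_combination k1
  rcases hc with e | e | e
  · rw [e, cr_self_left] at k2
    rw [← k2] at h
    simp at h
  · rw [e, cr_self_right] at k2
    rw [← k2] at h
    simp at h
  · rw [e] at k2
    rw [k2] at h
    exact absurd h (not_lt.mpr (mul_self_nonneg _))

end Translation

/-! ### Local finiteness and adjacency of lifted triangles -/

section LocalFinite

variable {L : Submodule ℤ Plane}

theorem finite_proj_preimage [DiscreteTopology L] [IsZLattice ℝ L] {V : Set (Torus L)}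
    (hV : V.Finite) (x : Plane) (R : ℝ) :
    (proj L ⁻¹' V ∩ Metric.closedBall x R).Finite := by
  have hcl : IsClosed (L : Set Plane) := by
    rw [← Submodule.coe_toAddSubgroup]
    exact AddSubgroup.isClosed_of_discrete
  have hL : ∀ y : Plane, (Metric.closedBall y R ∩ (L : Set Plane)).Finite := fun y =>
    Metric.finite_isBounded_inter_isClosed DiscreteTopology.isDiscrete
        Metric.isBounded_closedBall hcl
  have : proj L ⁻¹' V ∩ Metric.closedBall x R =
      ⋃ w ∈ V, proj L ⁻¹' {w} ∩ Metric.closedBall x R := by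
    ext y
    simp
  rw [this]
  refine hV.biUnion fun w _ => ?_
  obtain ⟨q, rfl⟩ := L.mkQ_surjective w
  refine ((hL (x - q)).image (· + q)).subset ?_
  rintro y ⟨hy, hy'⟩
  refine ⟨y - q, ⟨?_, ?_⟩, by simp⟩
  · simpa [dist_eq_norm, sub_sub_sub_cancel_right] using hy'
  · exact (Submodule.Quotient.eq L).mp hy

variable {V : Set (Torus L)} {T : Set (TorusFace L)}

theorem IsTriangle.exists_bound {t : Set Plane} (h : IsTriangle t) :
    ∃ M : ℝ, ∀ q ∈ t, ∀ p, p ∈ t ∨ InDisk t p → dist p q ≤ M := by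
  obtain ⟨a, b, c, hcr, rfl⟩ := h.exists_cr
  obtain ⟨m, ha, hb, hc⟩ := exists_circle hcr
  obtain ⟨o, r, hr, hm⟩ := exists_center ha
  have hz : ∀ q ∈ ({a, b, c} : Set Plane), pw m q = 0 := by
    rintro q (rfl | rfl | rfl) <;> assumption
  have hle : ∀ p, pw m p ≤ 0 → dist p o ≤ r := by
    intro p hp
    by_contra hcon
    exact absurd ((sphere_iff_pw hr hm p).2.2.mp hcon) (not_lt.mpr hp)
  refine ⟨r + r, fun q hq p hp => ?_⟩
  have h1 : dist p o ≤ r := by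
    rcases hp with hp | hp
    · exact hle p (hz p hp).le
    · exact hle p ((inDisk_triple_iff hcr ha hb hc).mp hp).le
  have h2 := hle q (hz q hq).le
  rw [dist_comm] at h2
  exact (dist_triangle p o q).trans (add_le_add h1 h2)

variable (hT : IsGeometricTriangulation L V T)
include hT

theorem IsGeometricTriangulation.cr_ne_zero {a b c : Plane} (h : {a, b, c} ∈ lifts L T) :
    cr a b c ≠ 0 :=
  isTriangle_triple_iff.mp (hT.isTriangle _ h)

/-- The bound is translation invariant and there are finitely many faces on the torus, so one
constant serves all lifts. -/
theorem IsGeometricTriangulation.exists_bound :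
    ∃ M : ℝ, ∀ t ∈ lifts L T, ∀ q ∈ t, ∀ p, p ∈ t ∨ InDisk t p → dist p q ≤ M := by
  have key : ∀ F : TorusFace L, ∃ M : ℝ, F ∈ T → ∀ t, projFace L t = F → ∀ q ∈ t, ∀ p,
      p ∈ t ∨ InDisk t p → dist p q ≤ M := by
    intro F
    by_cases hF : F ∈ T
    · obtain ⟨t₀, rfl⟩ := Quotient.exists_rep F
      obtain ⟨M, hM⟩ := (hT.isTriangle t₀ hF).exists_bound
      refine ⟨M, fun _ t ht => ?_⟩
      obtain ⟨v, rfl⟩ := projFace_eq_iff.mp ht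
      rintro _ ⟨q, hq, rfl⟩ p hp
      have := hM q hq (-v +ᵥ p) (by
        rcases hp with ⟨p, hp, rfl⟩ | hp
        · left; exact (neg_vadd_vadd v p).symm ▸ hp
        · right; simpa using inDisk_vadd_of (-v) hp)
      have e : dist p (v +ᵥ q) = dist (-v +ᵥ p) q := by
        conv_lhs => rw [← vadd_neg_vadd v p]
        exact dist_add_left _ _ _
      exact e.trans_le this
    · exact ⟨0, fun h => absurd h hF⟩
  choose M hM using key
  obtain ⟨B, hB⟩ := (hT.finite.image M).bddAbove
  exact ⟨B, fun t ht q hq p hp =>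
    (hM _ ht t rfl q hq p hp).trans (hB (Set.mem_image_of_mem _ ht))⟩

theorem IsGeometricTriangulation.finite_near [DiscreteTopology L] [IsZLattice ℝ L] (hV : V.Finite)
    (x : Plane) (R : ℝ) :
    {t ∈ lifts L T | ∃ y ∈ convexHull ℝ t, dist y x ≤ R}.Finite := by
  obtain ⟨M, hM⟩ := hT.exists_bound
  refine (finite_proj_preimage hV x (R + M + M)).finite_subsets.subset ?_
  rintro t ⟨ht, y, hy, hyx⟩ p hp
  refine ⟨hT.vertices ▸ ⟨t, ht, hp⟩, ?_⟩
  have hball : t ⊆ Metric.closedBall p M := fun q hq => hM t ht p hp q (Or.inl hq)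
  have h1 : dist y p ≤ M := convexHull_min hball (convex_closedBall p M) hy
  have h2 : 0 ≤ M := dist_nonneg.trans h1
  rw [dist_comm] at h1
  rw [Metric.mem_closedBall]
  linarith [dist_triangle p y x]

theorem IsGeometricTriangulation.finite_inDisk [DiscreteTopology L] [IsZLattice ℝ L]
    (hV : V.Finite) (x : Plane) : {t ∈ lifts L T | InDisk t x}.Finite := by
  obtain ⟨M, hM⟩ := hT.exists_bound
  refine (hT.finite_near hV x M).subset ?_
  rintro t ⟨ht, hx⟩
  obtain ⟨a, b, c, -, rfl⟩ := (hT.isTriangle t ht).exists_cr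
  exact ⟨ht, a, subset_convexHull ℝ _ (by simp),
    by rw [dist_comm]; exact hM _ ht a (by simp) x (Or.inr hx)⟩

theorem IsGeometricTriangulation.mem_of_mem_hull {p : Plane} (hp : p ∈ ⋃₀ lifts L T) {t : Set Plane}
    (ht : t ∈ lifts L T) (h : p ∈ convexHull ℝ t) : p ∈ t := by
  obtain ⟨s, hs, hps⟩ := hp
  have h1 := hT.inter s hs t ht ⟨subset_convexHull ℝ s hps, h⟩
  by_contra hpt
  obtain ⟨q, r, rfl, hcr⟩ := (hT.isTriangle s hs).exists_eq_insert hps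
  exact notMem_hull_of_notMem hcr Set.inter_subset_left (fun h => hpt h.2)
    (by rwa [cr_rotate]) h1

/-- Two triangles on the same side of `ab` overlap near the midpoint of `ab`, at points off the line
`ab`, whereas their common face is contained in that line. -/
theorem IsGeometricTriangulation.opposite {a b c d : Plane} (hc : {a, b, c} ∈ lifts L T)
    (hd : {a, b, d} ∈ lifts L T) (hcd : c ≠ d) : cr a b c * cr a b d < 0 := by
  have nc := hT.cr_ne_zero hc
  have nd := hT.cr_ne_zero hd
  by_contra hcon
  have hpos : 0 < cr a b c * cr a b d :=
    lt_of_le_of_ne (not_lt.mp hcon) (mul_ne_zero nc nd).symm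
  obtain ⟨α, β, γ, hs, c0, c1⟩ := exists_barycentric nd c
  have hγ : cr a b c = γ * cr a b d := by
    have := cr_barycentric a b hs c0 c1
    rw [cr_self_left, cr_self_right] at this
    linarith
  have hγ0 : 0 < γ := by
    rw [hγ] at hpos
    by_contra h0
    nlinarith [mul_self_nonneg (cr a b d)]
  -- With this choice `(1 - ε) / 2 = ε * (|α| + |β|)`, which keeps the weights of `a` and `b`
  -- relative to `abd` nonnegative.
  set ε := 1 / (1 + 2 * |α| + 2 * |β|) with hε
  have hε0 : 0 < ε := by positivity
  have hεeq : ε + 2 * (ε * |α|) + 2 * (ε * |β|) = 1 := by rw [hε]; field_simp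
  have k1 : 0 ≤ ε * |α| := by positivity
  have k2 : 0 ≤ ε * |β| := by positivity
  have k3 : -(ε * |α|) ≤ ε * α := by nlinarith [neg_abs_le α]
  have k4 : -(ε * |β|) ≤ ε * β := by nlinarith [neg_abs_le β]
  let x : Plane := !₂[(1 - ε) / 2 * a 0 + (1 - ε) / 2 * b 0 + ε * c 0,
    (1 - ε) / 2 * a 1 + (1 - ε) / 2 * b 1 + ε * c 1]
  have x0 : x 0 = (1 - ε) / 2 * a 0 + (1 - ε) / 2 * b 0 + ε * c 0 := by simp [x]
  have x1 : x 1 = (1 - ε) / 2 * a 1 + (1 - ε) / 2 * b 1 + ε * c 1 := by simp [x]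
  have h1 : x ∈ convexHull ℝ {a, b, c} :=
    mem_hull_triple.mpr ⟨_, _, _, by linarith, by linarith, hε0.le, by ring, x0, x1⟩
  have h2 : x ∈ convexHull ℝ {a, b, d} := by
    refine mem_hull_triple.mpr ⟨(1 - ε) / 2 + ε * α, (1 - ε) / 2 + ε * β, ε * γ, by linarith,
      by linarith, by positivity, ?_, ?_, ?_⟩
    · linear_combination ε * hs
    · rw [x0, c0]; ring
    · rw [x1, c1]; ring
  have h3 := hT.inter _ hc _ hd ⟨h1, h2⟩
  have hx : cr a b x = ε * cr a b c := by
    rw [cr_barycentric a b (by ring) x0 x1, cr_self_left, cr_self_right]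
    ring
  refine notMem_hull_of_notMem (a := c) (b := a) (c := b) (e := {a, b, c} ∩ {a, b, d})
    (by rwa [← cr_rotate]) ?_ ?_ (by rw [hx]; exact mul_ne_zero hε0.ne' nc) h3
  · rintro y ⟨rfl | rfl | rfl, -⟩ <;> simp
  · obtain ⟨-, h4, h5⟩ := ne_of_cr_ne_zero nc
    rintro ⟨-, h | h | h⟩
    · exact h4 h.symm
    · exact h5 h.symm
    · exact hcd h

theorem IsGeometricTriangulation.eq_or_eq {a b c d : Plane} {s : Set Plane}
    (hc : {a, b, c} ∈ lifts L T) (hd : {a, b, d} ∈ lifts L T) (hcd : c ≠ d) (hs : s ∈ lifts L T)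
    (ha : a ∈ s) (hb : b ∈ s) : s = {a, b, c} ∨ s = {a, b, d} := by
  obtain ⟨e, rfl, -⟩ := (hT.isTriangle s hs).exists_eq_insert_insert ha hb
    (ne_of_cr_ne_zero (hT.cr_ne_zero hc)).1
  by_contra! hcon
  have h1 : e ≠ c := by rintro rfl; exact hcon.1 rfl
  have h2 : e ≠ d := by rintro rfl; exact hcon.2 rfl
  have k1 := hT.opposite hs hc h1
  have k2 := hT.opposite hs hd h2
  have k3 := hT.opposite hc hd hcd
  nlinarith [mul_pos_of_neg_of_neg k1 k2, mul_self_nonneg (cr a b e)]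

theorem IsGeometricTriangulation.exists_neighbor [DiscreteTopology L] [IsZLattice ℝ L]
    (hV : V.Finite) {a b c : Plane} (h : {a, b, c} ∈ lifts L T) :
    ∃ d, {a, b, d} ∈ lifts L T ∧ c ≠ d := by
  have hcr := hT.cr_ne_zero h
  let m : Plane := !₂[(a 0 + b 0) / 2, (a 1 + b 1) / 2]
  have m0 : m 0 = (a 0 + b 0) / 2 := by simp [m]
  have m1 : m 1 = (a 1 + b 1) / 2 := by simp [m]
  -- The midpoint lies off the lines `bc` and `ac`, so a second triangle containing it must have
  -- both `a` and `b` as vertices.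
  suffices ∃ s ∈ lifts L T, s ≠ {a, b, c} ∧ m ∈ convexHull ℝ s by
    obtain ⟨s, hs, hne, hm⟩ := this
    have hmt : m ∈ convexHull ℝ {a, b, c} := mem_hull_triple.mpr
      ⟨1 / 2, 1 / 2, 0, by norm_num, by norm_num, le_rfl, by norm_num, by linarith, by linarith⟩
    have hm' := hT.inter _ h _ hs ⟨hmt, hm⟩
    have ha : a ∈ s := by
      by_contra ha
      refine notMem_hull_of_notMem hcr Set.inter_subset_left (fun h => ha h.2) ?_ hm'
      have : cr b c m = cr a b c / 2 := by unfold cr; rw [m0, m1]; ring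
      rw [this]
      exact div_ne_zero hcr two_ne_zero
    have hb : b ∈ s := by
      by_contra hb
      refine notMem_hull_of_notMem (a := b) (b := a) (c := c) (e := {a, b, c} ∩ s) ?_
        (fun y hy => by rw [Set.insert_comm]; exact hy.1) (fun h => hb h.2) ?_ hm'
      · rw [cr_swap]; exact neg_ne_zero.mpr hcr
      · have : cr a c m = -cr a b c / 2 := by unfold cr; rw [m0, m1]; ring
        rw [this]
        exact div_ne_zero (neg_ne_zero.mpr hcr) two_ne_zero
    obtain ⟨d, rfl, -⟩ := (hT.isTriangle s hs).exists_eq_insert_insert ha hb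
      (ne_of_cr_ne_zero hcr).1
    exact ⟨d, hs, by rintro rfl; exact hne rfl⟩
  by_contra! hcon
  have hfin := hT.finite_near hV m 1
  set N := {t ∈ lifts L T | ∃ y ∈ convexHull ℝ t, dist y m ≤ 1} \ {{a, b, c}} with hN
  have hclosed : IsClosed (⋃ s ∈ N, convexHull ℝ s) := by
    refine hfin.sdiff.isClosed_biUnion fun s hs => ?_
    obtain ⟨p, q, r, -, rfl⟩ := (hT.isTriangle s hs.1.1).exists_cr
    exact (Set.toFinite _).isClosed_convexHull ℝ
  have hm : m ∈ (⋃ s ∈ N, convexHull ℝ s)ᶜ := by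
    simp only [Set.mem_compl_iff, Set.mem_iUnion, not_exists]
    exact fun s hs => hcon s hs.1.1 hs.2
  -- Points just beyond `ab`, outside `abc`. The finitely many other nearby triangles form a closed
  -- set missing `m`, so for small `ε` nothing would cover `y ε`.
  let y : ℝ → Plane := fun ε => m + ε • (m - c)
  have hy : Filter.Tendsto y (nhdsWithin 0 (Set.Ioi 0)) (nhds m) := by
    have : Continuous y := by fun_prop
    have h2 := this.tendsto 0
    simp only [y, zero_smul, add_zero] at h2
    exact h2.mono_left nhdsWithin_le_nhds
  have e1 := hy.eventually (hclosed.isOpen_compl.mem_nhds hm)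
  have e2 := hy.eventually (Metric.closedBall_mem_nhds m one_pos)
  obtain ⟨ε, ⟨h1, h2⟩, h3⟩ := ((e1.and e2).and self_mem_nhdsWithin).exists
  obtain ⟨s, hs, hys⟩ := Set.mem_iUnion₂.mp (hT.cover.symm ▸ Set.mem_univ (y ε))
  by_cases hst : s = {a, b, c}
  · subst hst
    obtain ⟨α, β, γ, -, -, hγ, hsum, y0, y1⟩ := mem_hull_triple.mp hys
    have k1 := cr_barycentric a b hsum y0 y1
    rw [cr_self_left, cr_self_right] at k1
    have k2 : cr a b (y ε) = -ε * cr a b c := by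
      unfold cr
      simp only [y, PiLp.add_apply, PiLp.smul_apply, PiLp.sub_apply, smul_eq_mul, m0, m1]
      ring
    have k3 : (γ + ε) * cr a b c = 0 := by linarith
    have h3' : 0 < ε := h3
    exact mul_ne_zero (by positivity) hcr k3
  · exact h1 (Set.mem_iUnion₂.mpr ⟨s, ⟨⟨hs, _, hys, h2⟩, hst⟩, hys⟩)

end LocalFinite

/-! ### Flips preserve geometric triangulations -/

variable {L : Submodule ℤ Plane} {V : Set (Torus L)} {T : Set (TorusFace L)} {a b c d : Plane}

theorem Crossing.vadd (h : Crossing a b c d) (v : L) :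
    Crossing (v +ᵥ a) (v +ᵥ b) (v +ᵥ c) (v +ᵥ d) := by
  obtain ⟨s, t, h1, h2, h3, h4, e0, e1⟩ := h
  refine ⟨s, t, h1, h2, h3, h4, ?_, ?_⟩ <;> simp only [vadd_coord] <;> linarith

theorem AdjacentLifts.vadd (h : AdjacentLifts L T a b c d) (v : L) :
    AdjacentLifts L T (v +ᵥ a) (v +ᵥ b) (v +ᵥ c) (v +ᵥ d) := by
  obtain ⟨h1, h2, h3⟩ := h
  refine ⟨?_, ?_, fun e => h3 (vadd_left_cancel v e)⟩
  · rw [← vadd_triple]; exact vadd_mem_lifts.mpr h1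
  · rw [← vadd_triple]; exact vadd_mem_lifts.mpr h2

theorem AdjacentLifts.symm (h : AdjacentLifts L T a b c d) : AdjacentLifts L T b a d c :=
  ⟨h.2.1, h.1, h.2.2.symm⟩

theorem AdjacentLifts.opposite (h : AdjacentLifts L T a b c d)
    (hT : IsGeometricTriangulation L V T) : cr a b c * cr a b d < 0 :=
  hT.opposite h.1 (by rw [Set.insert_comm]; exact h.2.1) h.2.2

theorem DelaunayFlippable.crossing (h : DelaunayFlippable L T a b c d)
    (hT : IsGeometricTriangulation L V T) : Crossing a b c d := by
  obtain ⟨hadj, h1, h2⟩ := h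
  obtain ⟨m, mc, md, mb, ma⟩ := outsideCircumdisk_iff.mp h1
  obtain ⟨n, nd, nc, na, nb⟩ := outsideCircumdisk_iff.mp h2
  exact crossing_of_outside (hadj.opposite hT) mc md mb ma nc nd na nb

theorem mem_lifts_flip {s : Set Plane} : s ∈ lifts L (flip L T a b c d) ↔
    (s ∈ lifts L T ∧ (∀ v : L, v +ᵥ ({a, b, c} : Set Plane) ≠ s) ∧
      ∀ v : L, v +ᵥ ({b, a, d} : Set Plane) ≠ s) ∨
    ∃ v : L, v +ᵥ ({c, d, b} : Set Plane) = s ∨ v +ᵥ ({d, c, a} : Set Plane) = s := by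
  unfold lifts flip
  rw [Set.mem_ofPred_eq, Set.mem_union, Set.mem_sdiff, Set.mem_insert_iff, Set.mem_singleton_iff,
    Set.mem_insert_iff, Set.mem_singleton_iff, projFace_eq_iff, projFace_eq_iff, projFace_eq_iff,
    projFace_eq_iff, exists_or, not_or, not_exists, not_exists]
  rfl

/-- The triangle `N` is covered by `t₁` and `t₂`, and it meets the common faces of these with the
other triangles of `T` in common faces. -/
structure Refits (L : Submodule ℤ Plane) (T : Set (TorusFace L)) (t₁ t₂ N : Set Plane) : Prop where
  mem₁ : t₁ ∈ lifts L T
  mem₂ : t₂ ∈ lifts L T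
  subset : convexHull ℝ N ⊆ convexHull ℝ t₁ ∪ convexHull ℝ t₂
  inter : ∀ t, (t = t₁ ∨ t = t₂) → ∀ s ∈ lifts L T, s ≠ t₁ → s ≠ t₂ → ∀ e ⊆ t ∩ s,
    convexHull ℝ e ∩ convexHull ℝ N ⊆ convexHull ℝ (e ∩ N)

theorem Refits.symm {t₁ t₂ N : Set Plane} (h : Refits L T t₁ t₂ N) : Refits L T t₂ t₁ N :=
  ⟨h.mem₂, h.mem₁, by rw [Set.union_comm]; exact h.subset,
    fun t ht s hs h1 h2 => h.inter t ht.symm s hs h2 h1⟩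

theorem Refits.inter_old (hT : IsGeometricTriangulation L V T) {t₁ t₂ N s : Set Plane}
    (h : Refits L T t₁ t₂ N) (hs : s ∈ lifts L T) (h₁ : s ≠ t₁) (h₂ : s ≠ t₂) :
    convexHull ℝ s ∩ convexHull ℝ N ⊆ convexHull ℝ (s ∩ N) := by
  rintro x ⟨hx, hxN⟩
  have key : ∀ t, (t = t₁ ∨ t = t₂) → t ∈ lifts L T → x ∈ convexHull ℝ t →
      x ∈ convexHull ℝ (s ∩ N) := fun t ht htT hxt =>
    convexHull_mono (Set.inter_subset_inter_left N Set.inter_subset_right)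
      (h.inter t ht s hs h₁ h₂ _ subset_rfl ⟨hT.inter _ htT _ hs ⟨hxt, hx⟩, hxN⟩)
  rcases h.subset hxN with hx' | hx'
  · exact key t₁ (Or.inl rfl) h.mem₁ hx'
  · exact key t₂ (Or.inr rfl) h.mem₂ hx'

theorem Refits.inter_new (hT : IsGeometricTriangulation L V T) {t₁ t₂ N s₁ s₂ M : Set Plane}
    (h : Refits L T t₁ t₂ N) (h' : Refits L T s₁ s₂ M) (h₁₁ : t₁ ≠ s₁) (h₁₂ : t₁ ≠ s₂)
    (h₂₁ : t₂ ≠ s₁) (h₂₂ : t₂ ≠ s₂) :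
    convexHull ℝ N ∩ convexHull ℝ M ⊆ convexHull ℝ (N ∩ M) := by
  rintro x ⟨hxN, hxM⟩
  have key : ∀ t s, (t = t₁ ∨ t = t₂) → (s = s₁ ∨ s = s₂) → t ∈ lifts L T → s ∈ lifts L T →
      x ∈ convexHull ℝ t → x ∈ convexHull ℝ s → x ∈ convexHull ℝ (N ∩ M) := by
    intro t s ht hs htT hsT hxt hxs
    have k1 := h.inter t ht s hsT (by rcases hs with rfl | rfl <;> symm <;> assumption)
      (by rcases hs with rfl | rfl <;> symm <;> assumption) _ subset_rfl
      ⟨hT.inter _ htT _ hsT ⟨hxt, hxs⟩, hxN⟩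
    -- The common face has already been cut down by `N`; this is why `Refits.inter` allows every `e
    -- ⊆ t ∩ s`.
    have k2 := h'.inter s hs t htT (by rcases ht with rfl | rfl <;> assumption)
      (by rcases ht with rfl | rfl <;> assumption) (t ∩ s ∩ N)
      (fun y hy => ⟨hy.1.2, hy.1.1⟩) ⟨k1, hxM⟩
    refine convexHull_mono ?_ k2
    exact fun y hy => ⟨hy.1.2, hy.2⟩
  rcases h.subset hxN with h1 | h1 <;> rcases h'.subset hxM with h2 | h2
  · exact key t₁ s₁ (Or.inl rfl) (Or.inl rfl) h.mem₁ h'.mem₁ h1 h2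
  · exact key t₁ s₂ (Or.inl rfl) (Or.inr rfl) h.mem₁ h'.mem₂ h1 h2
  · exact key t₂ s₁ (Or.inr rfl) (Or.inl rfl) h.mem₂ h'.mem₁ h1 h2
  · exact key t₂ s₂ (Or.inr rfl) (Or.inr rfl) h.mem₂ h'.mem₂ h1 h2

theorem AdjacentLifts.refits (hadj : AdjacentLifts L T a b c d)
    (hT : IsGeometricTriangulation L V T) (hx : Crossing a b c d) :
    Refits L T {a, b, c} {b, a, d} {c, d, b} := by
  have hd : {a, b, d} ∈ lifts L T := by rw [Set.insert_comm]; exact hadj.2.1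
  have hsd := (hx.sides (hT.cr_ne_zero hadj.1)).2
  refine ⟨hadj.1, hadj.2.1, ?_, ?_⟩
  · rw [Set.union_comm]
    exact hx.symm.swap_right.hull_subset
  · intro t ht s hs h1 h2 e he
    have hab : ¬ (a ∈ e ∧ b ∈ e) := by
      rintro ⟨ha, hb⟩
      rcases hT.eq_or_eq hadj.1 hd hadj.2.2 hs (he ha).2 (he hb).2 with rfl | rfl
      · exact h1 rfl
      · exact h2 (Set.insert_comm _ _ _)
    rcases ht with rfl | rfl
    · exact hull_inter_subset hsd (fun y hy => (he hy).1) hab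
    · rw [Set.insert_comm c d]
      refine hull_inter_subset (a := a) ?_ (fun y hy => ?_) hab
      · rwa [cr_swap c d, cr_swap c d, neg_mul_neg]
      · rw [Set.insert_comm]; exact (he hy).1

theorem AdjacentLifts.refits' (hadj : AdjacentLifts L T a b c d)
    (hT : IsGeometricTriangulation L V T) (hx : Crossing a b c d) :
    Refits L T {a, b, c} {b, a, d} {d, c, a} :=
  (hadj.symm.refits hT hx.swap_left.swap_right).symm

theorem AdjacentLifts.refits_vadd (hadj : AdjacentLifts L T a b c d)
    (hT : IsGeometricTriangulation L V T) (hx : Crossing a b c d) (v : L) {N : Set Plane}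
    (hN : v +ᵥ ({c, d, b} : Set Plane) = N ∨ v +ᵥ ({d, c, a} : Set Plane) = N) :
    Refits L T (v +ᵥ {a, b, c}) (v +ᵥ {b, a, d}) N := by
  rcases hN with rfl | rfl
  · simpa only [vadd_triple] using (hadj.vadd v).refits hT (hx.vadd v)
  · simpa only [vadd_triple] using (hadj.vadd v).refits' hT (hx.vadd v)

theorem AdjacentLifts.vadd_ne (hadj : AdjacentLifts L T a b c d)
    (hT : IsGeometricTriangulation L V T) {v w : L} (hvw : v ≠ w) :
    v +ᵥ ({a, b, c} : Set Plane) ≠ w +ᵥ {a, b, c} := by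
  intro h
  have : (-w + v) +ᵥ ({a, b, c} : Set Plane) = {a, b, c} := by
    rw [add_vadd, h, neg_vadd_vadd]
  have := eq_zero_of_vadd_triple (hT.cr_ne_zero hadj.1) this
  exact hvw (neg_add_eq_zero.mp this).symm

theorem AdjacentLifts.vadd_ne' (hadj : AdjacentLifts L T a b c d)
    (hT : IsGeometricTriangulation L V T) (v w : L) :
    v +ᵥ ({a, b, c} : Set Plane) ≠ w +ᵥ {b, a, d} := by
  intro h
  have : (-w + v) +ᵥ ({a, b, c} : Set Plane) = {a, b, d} := by
    rw [add_vadd, h, neg_vadd_vadd, Set.insert_comm]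
  exact vadd_triple_ne (hadj.opposite hT) this

theorem hull_new_inter_vadd (hx : Crossing a b c d) (h : cr a b c ≠ 0) (v : L) {N M : Set Plane}
    (hN : v +ᵥ ({c, d, b} : Set Plane) = N ∨ v +ᵥ ({d, c, a} : Set Plane) = N)
    (hM : v +ᵥ ({c, d, b} : Set Plane) = M ∨ v +ᵥ ({d, c, a} : Set Plane) = M) :
    convexHull ℝ N ∩ convexHull ℝ M ⊆ convexHull ℝ (N ∩ M) := by
  have key := hull_new_inter ((hx.vadd v).sides (by rwa [cr_vadd])).2
  rw [← vadd_triple, ← vadd_triple] at key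
  rcases hN with rfl | rfl <;> rcases hM with rfl | rfl
  · simp
  · exact key
  · rw [Set.inter_comm, Set.inter_comm (v +ᵥ _)]
    exact key
  · simp

/-- Flipping the diagonal of a strictly convex quadrilateral preserves triangulations. -/
theorem IsGeometricTriangulation.flip (hT : IsGeometricTriangulation L V T)
    (hadj : AdjacentLifts L T a b c d) (hx : Crossing a b c d) :
    IsGeometricTriangulation L V (flip L T a b c d) := by
  have hcr := hT.cr_ne_zero hadj.1
  refine ⟨?_, ?_, ?_, ?_, ?_⟩
  · exact hT.finite.sdiff.union (Set.toFinite _)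
  · intro s hs
    rcases mem_lifts_flip.mp hs with ⟨h, -⟩ | ⟨v, rfl | rfl⟩
    · exact hT.isTriangle s h
    · rw [vadd_triple, isTriangle_triple_iff, cr_vadd]
      exact (hx.noncol hcr).2.1
    · rw [vadd_triple, isTriangle_triple_iff, cr_vadd, cr_swap]
      exact neg_ne_zero.mpr (hx.noncol hcr).2.2
  · rw [← hT.vertices]
    apply Set.Subset.antisymm
    · rintro p ⟨s, hs, hp⟩
      rcases mem_lifts_flip.mp hs with ⟨h, -⟩ | ⟨v, hN⟩
      · exact ⟨s, h, hp⟩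
      · have h1 := (hadj.vadd v).1
        have h2 := (hadj.vadd v).2.1
        rcases hN with rfl | rfl <;> rw [vadd_triple] at hp <;> rcases hp with rfl | rfl | rfl
        · exact ⟨_, h1, by simp⟩
        · exact ⟨_, h2, by simp⟩
        · exact ⟨_, h1, by simp⟩
        · exact ⟨_, h2, by simp⟩
        · exact ⟨_, h1, by simp⟩
        · exact ⟨_, h1, by simp⟩
    · rintro p ⟨s, hs, hp⟩
      by_cases h1 : ∀ v : L, v +ᵥ ({a, b, c} : Set Plane) ≠ s
      · by_cases h2 : ∀ v : L, v +ᵥ ({b, a, d} : Set Plane) ≠ s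
        · exact ⟨s, mem_lifts_flip.mpr (Or.inl ⟨hs, h1, h2⟩), hp⟩
        · push Not at h2
          obtain ⟨v, rfl⟩ := h2
          rw [vadd_triple] at hp
          rcases hp with rfl | rfl | rfl
          · exact ⟨_, mem_lifts_flip.mpr (Or.inr ⟨v, Or.inl rfl⟩), by simp [vadd_triple]⟩
          · exact ⟨_, mem_lifts_flip.mpr (Or.inr ⟨v, Or.inr rfl⟩), by simp [vadd_triple]⟩
          · exact ⟨_, mem_lifts_flip.mpr (Or.inr ⟨v, Or.inr rfl⟩), by simp [vadd_triple]⟩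
      · push Not at h1
        obtain ⟨v, rfl⟩ := h1
        rw [vadd_triple] at hp
        rcases hp with rfl | rfl | rfl
        · exact ⟨_, mem_lifts_flip.mpr (Or.inr ⟨v, Or.inr rfl⟩), by simp [vadd_triple]⟩
        · exact ⟨_, mem_lifts_flip.mpr (Or.inr ⟨v, Or.inl rfl⟩), by simp [vadd_triple]⟩
        · exact ⟨_, mem_lifts_flip.mpr (Or.inr ⟨v, Or.inr rfl⟩), by simp [vadd_triple]⟩
  · rw [Set.eq_univ_iff_forall]
    intro x
    obtain ⟨s, hs, hxs⟩ := Set.mem_iUnion₂.mp (hT.cover.symm ▸ Set.mem_univ x)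
    rw [Set.mem_iUnion₂]
    have key : ∀ v : L, x ∈ convexHull ℝ (v +ᵥ ({c, d, b} : Set Plane)) ∪
        convexHull ℝ (v +ᵥ ({d, c, a} : Set Plane)) →
        ∃ i, ∃ (_ : i ∈ lifts L (FlatTorus.flip L T a b c d)), x ∈ convexHull ℝ i := by
      rintro v (h | h)
      · exact ⟨_, mem_lifts_flip.mpr (Or.inr ⟨v, Or.inl rfl⟩), h⟩
      · exact ⟨_, mem_lifts_flip.mpr (Or.inr ⟨v, Or.inr rfl⟩), h⟩
    by_cases h1 : ∀ v : L, v +ᵥ ({a, b, c} : Set Plane) ≠ s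
    · by_cases h2 : ∀ v : L, v +ᵥ ({b, a, d} : Set Plane) ≠ s
      · exact ⟨s, mem_lifts_flip.mpr (Or.inl ⟨hs, h1, h2⟩), hxs⟩
      · push Not at h2
        obtain ⟨v, rfl⟩ := h2
        apply key v
        rw [Set.union_comm]
        rw [vadd_triple] at hxs ⊢
        rw [vadd_triple]
        exact (hx.vadd v).swap_left.swap_right.hull_subset hxs
    · push Not at h1
      obtain ⟨v, rfl⟩ := h1
      apply key v
      rw [vadd_triple] at hxs ⊢
      rw [vadd_triple]
      exact (hx.vadd v).hull_subset hxs
  · intro s hs t ht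
    rcases mem_lifts_flip.mp hs with ⟨hs1, hs2, hs3⟩ | ⟨v, hs⟩ <;>
      rcases mem_lifts_flip.mp ht with ⟨ht1, ht2, ht3⟩ | ⟨w, ht⟩
    · exact hT.inter s hs1 t ht1
    · exact (hadj.refits_vadd hT hx w ht).inter_old hT hs1 (hs2 w).symm (hs3 w).symm
    · rw [Set.inter_comm, Set.inter_comm s]
      exact (hadj.refits_vadd hT hx v hs).inter_old hT ht1 (ht2 v).symm (ht3 v).symm
    -- New triangles from the same translate of the quadrilateral share its new diagonal; those from
    -- different translates refit disjoint pairs of old triangles.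
    · by_cases hvw : v = w
      · subst hvw
        exact hull_new_inter_vadd hx hcr v hs ht
      · exact (hadj.refits_vadd hT hx v hs).inter_new hT (hadj.refits_vadd hT hx w ht)
          (hadj.vadd_ne hT hvw) (hadj.vadd_ne' hT v w) (hadj.vadd_ne' hT w v).symm
          (hadj.symm.vadd_ne hT hvw)

/-! ### Flippable edges and circumdisks -/

theorem DelaunayFlippable.exists_diskConfig (h : DelaunayFlippable L T a b c d)
    (hT : IsGeometricTriangulation L V T) : ∃ f₁ f₂ g₁ g₂, DiskConfig a b c d f₁ f₂ g₁ g₂ := by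
  have hx := h.crossing hT
  have hcr := hT.cr_ne_zero h.1.1
  obtain ⟨f₁, f₂, g₁, g₂, -, ⟨gc, gd, gb⟩, key⟩ := FlatTorus.exists_diskConfig hx hcr
  obtain ⟨m, mc, md, mb, ma⟩ := outsideCircumdisk_iff.mp h.2.1
  refine ⟨f₁, f₂, g₁, g₂, key (Or.inr ?_)⟩
  rwa [circle_unique (hx.noncol hcr).2.1 (gc.trans mc.symm) (gd.trans md.symm) (gb.trans mb.symm)]

theorem AdjacentLifts.flippable_of_inDisk (h : AdjacentLifts L T a b c d)
    (hT : IsGeometricTriangulation L V T) (hd : InDisk {a, b, c} d) :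
    DelaunayFlippable L T a b c d := by
  have hcr := hT.cr_ne_zero h.1
  obtain ⟨m, ma, mb, mc, md⟩ := inDisk_triple.mp hd
  have hx := crossing_of_inDisk (h.opposite hT) ma mb mc md
  obtain ⟨f₁, f₂, g₁, g₂, ⟨fa, fb, fc⟩, -, key⟩ := FlatTorus.exists_diskConfig hx hcr
  have cfg := key (Or.inl (by
    rwa [circle_unique hcr (fa.trans ma.symm) (fb.trans mb.symm) (fc.trans mc.symm)]))
  exact ⟨h, outsideCircumdisk_iff.mpr ⟨g₁, cfg.g₁c, cfg.g₁d, cfg.g₁b, cfg.g₁a⟩,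
    outsideCircumdisk_iff.mpr ⟨g₂, cfg.g₂d, cfg.g₂c, cfg.g₂a, cfg.g₂b⟩⟩

theorem DelaunayFlip.isGeometricTriangulation {T' : Set (TorusFace L)} (h : DelaunayFlip L T T')
    (hT : IsGeometricTriangulation L V T) : IsGeometricTriangulation L V T' := by
  obtain ⟨a, b, c, d, hf, rfl⟩ := h
  exact hT.flip hf.1 (hf.crossing hT)

/-! ### Termination: the weight of a triangulation -/

/-- The points over `V` inside the circumdisk of `t`. -/
def diskPoints (V : Set (Torus L)) (t : Set Plane) : Set Plane :=
  {p | p ∈ proj L ⁻¹' V ∧ InDisk t p}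

theorem proj_vadd (v : L) (p : Plane) : proj L (v +ᵥ p) = proj L p := by
  refine (Submodule.Quotient.eq L).mpr ?_
  change (v : Plane) + p - p ∈ L
  rw [add_sub_cancel_right]
  exact v.2

theorem ncard_diskPoints_vadd (v : L) (t : Set Plane) :
    (diskPoints V (v +ᵥ t)).ncard = (diskPoints V t).ncard := by
  have : diskPoints V (v +ᵥ t) = (fun p : Plane => v +ᵥ p) '' diskPoints V t := by
    ext p
    constructor
    · rintro ⟨h1, h2⟩
      refine ⟨-v +ᵥ p, ⟨?_, ?_⟩, vadd_neg_vadd v p⟩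
      · rw [Set.mem_preimage, proj_vadd]; exact h1
      · rwa [← inDisk_vadd_iff v, vadd_neg_vadd]
    · rintro ⟨q, ⟨h1, h2⟩, rfl⟩
      refine ⟨?_, (inDisk_vadd_iff v).mpr h2⟩
      rw [Set.mem_preimage, proj_vadd]; exact h1
  rw [this, Set.ncard_image_of_injective _ (AddAction.injective v)]

/-- The number of lifted vertices inside the circumdisk of a lift of a face. -/
noncomputable def faceWeight (V : Set (Torus L)) : TorusFace L → ℕ :=
  Quotient.lift (fun t => (diskPoints V t).ncard) (by
    rintro s t ⟨v, rfl⟩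
    exact ncard_diskPoints_vadd v t)

theorem faceWeight_projFace (t : Set Plane) :
    faceWeight V (projFace L t) = (diskPoints V t).ncard := rfl

/-- The potential for termination. The sum runs over faces on the torus, which are finitely many in
a triangulation, and not over their lifts. -/
noncomputable def totalWeight (V : Set (Torus L)) (T : Set (TorusFace L)) : ℕ :=
  ∑ᶠ F ∈ T, faceWeight V F

theorem finite_diskPoints [DiscreteTopology L] [IsZLattice ℝ L] (hV : V.Finite)
    (h : cr a b c ≠ 0) : (diskPoints V {a, b, c}).Finite := by
  obtain ⟨M, hM⟩ := (isTriangle_triple_iff.mpr h).exists_bound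
  exact (finite_proj_preimage hV a M).subset fun p hp =>
    ⟨hp.1, hM a (by simp) p (Or.inr hp.2)⟩

theorem DiskConfig.ncard_lt [DiscreteTopology L] [IsZLattice ℝ L] (hV : V.Finite)
    {f₁ f₂ g₁ g₂ : ℝ × ℝ × ℝ} (h : DiskConfig a b c d f₁ f₂ g₁ g₂)
    (hd : d ∈ proj L ⁻¹' V) :
    (diskPoints V {c, d, b}).ncard + (diskPoints V {d, c, a}).ncard <
      (diskPoints V {a, b, c}).ncard + (diskPoints V {b, a, d}).ncard := by
  obtain ⟨n1, n2, n3⟩ := h.crossing.noncol h.noncol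
  have n1' : cr b a d ≠ 0 := by rw [cr_swap]; exact neg_ne_zero.mpr n1
  have n3' : cr d c a ≠ 0 := by rw [cr_swap]; exact neg_ne_zero.mpr n3
  have F1 := fun p => inDisk_triple_iff (p := p) h.noncol h.f₁a h.f₁b h.f₁c
  have F2 := fun p => inDisk_triple_iff (p := p) n1' h.f₂b h.f₂a h.f₂d
  have G1 := fun p => inDisk_triple_iff (p := p) n2 h.g₁c h.g₁d h.g₁b
  have G2 := fun p => inDisk_triple_iff (p := p) n3' h.g₂d h.g₂c h.g₂a
  have fF1 := finite_diskPoints hV h.noncol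
  have fF2 := finite_diskPoints hV n1'
  rw [← Set.ncard_union_add_ncard_inter _ _ (finite_diskPoints hV n2) (finite_diskPoints hV n3'),
    ← Set.ncard_union_add_ncard_inter _ _ fF1 fF2]
  refine add_lt_add_of_lt_of_le (Set.ncard_lt_ncard ?_ (fF1.union fF2))
    (Set.ncard_le_ncard ?_ (fF1.inter_of_left _))
  · rw [Set.ssubset_iff_of_subset]
    · refine ⟨d, Or.inl ⟨hd, (F1 d).mpr h.f₁d⟩, ?_⟩
      rintro (⟨-, h'⟩ | ⟨-, h'⟩)
      · exact absurd ((G1 d).mp h') (by rw [h.g₁d]; exact lt_irrefl 0)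
      · exact absurd ((G2 d).mp h') (by rw [h.g₂d]; exact lt_irrefl 0)
    · rintro p (⟨hp, h'⟩ | ⟨hp, h'⟩)
      · exact (h.union (Or.inl ((G1 p).mp h'))).imp (fun k => ⟨hp, (F1 p).mpr k⟩)
          (fun k => ⟨hp, (F2 p).mpr k⟩)
      · exact (h.union (Or.inr ((G2 p).mp h'))).imp (fun k => ⟨hp, (F1 p).mpr k⟩)
          (fun k => ⟨hp, (F2 p).mpr k⟩)
  · rintro p ⟨⟨hp, h1⟩, -, h2⟩
    obtain ⟨k1, k2⟩ := h.inter ((G1 p).mp h1) ((G2 p).mp h2)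
    exact ⟨⟨hp, (F1 p).mpr k1⟩, hp, (F2 p).mpr k2⟩

theorem totalWeight_flip_lt [DiscreteTopology L] [IsZLattice ℝ L] (hV : V.Finite)
    (hT : IsGeometricTriangulation L V T) (h : DelaunayFlippable L T a b c d) :
    totalWeight V (flip L T a b c d) < totalWeight V T := by
  obtain ⟨f₁, f₂, g₁, g₂, cfg⟩ := h.exists_diskConfig hT
  have hlt := cfg.ncard_lt (V := V) hV (hT.vertices ▸ ⟨_, h.1.2.1, by simp⟩)
  simp only [← faceWeight_projFace] at hlt
  set F₁ := projFace L {a, b, c}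
  set F₂ := projFace L {b, a, d}
  set G₁ := projFace L {c, d, b}
  set G₂ := projFace L {d, c, a}
  have hne : F₁ ≠ F₂ := by
    intro e
    obtain ⟨v, hv⟩ := projFace_eq_iff.mp e
    refine h.1.vadd_ne' hT 0 v ?_
    rw [zero_vadd, hv]
  have hsub : ({F₁, F₂} : Set (TorusFace L)) ⊆ T := by
    rintro F (rfl | rfl)
    · exact h.1.1
    · exact h.1.2.1
  have e1 : totalWeight V T =
      (∑ᶠ F ∈ T \ {F₁, F₂}, faceWeight V F) + (faceWeight V F₁ + faceWeight V F₂) := by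
    rw [← finsum_mem_pair hne, ← finsum_mem_union Set.disjoint_sdiff_left hT.finite.sdiff
      (Set.toFinite _), Set.sdiff_union_of_subset hsub]
    rfl
  -- Coincidences among the new faces, or with the remaining ones, only lower the sum. Distinctness
  -- is needed for the old pair alone.
  have e2 : totalWeight V (flip L T a b c d) ≤
      (∑ᶠ F ∈ T \ {F₁, F₂}, faceWeight V F) + ∑ᶠ F ∈ ({G₁, G₂} : Set _), faceWeight V F := by
    rw [← finsum_mem_union_inter hT.finite.sdiff (Set.toFinite _)]
    exact Nat.le_add_right _ _
  have e3 : ∑ᶠ F ∈ ({G₁, G₂} : Set _), faceWeight V F ≤ faceWeight V G₁ + faceWeight V G₂ := by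
    by_cases hG : G₁ = G₂
    · rw [hG, Set.pair_eq_singleton, finsum_mem_singleton]
      exact Nat.le_add_right _ _
    · exact (finsum_mem_pair hG).le
  omega

theorem DelaunayFlip.totalWeight_lt [DiscreteTopology L] [IsZLattice ℝ L] (hV : V.Finite)
    (hT : IsGeometricTriangulation L V T) {T' : Set (TorusFace L)} (h : DelaunayFlip L T T') :
    totalWeight V T' < totalWeight V T := by
  obtain ⟨a, b, c, d, hf, rfl⟩ := h
  exact totalWeight_flip_lt hV hT hf

theorem not_exists_infinite_flips [DiscreteTopology L] [IsZLattice ℝ L] (hV : V.Finite)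
    (hT : IsGeometricTriangulation L V T) :
    ¬ ∃ s : ℕ → Set (TorusFace L), s 0 = T ∧ ∀ k, DelaunayFlip L (s k) (s (k + 1)) := by
  rintro ⟨s, rfl, hs⟩
  have hg : ∀ k, IsGeometricTriangulation L V (s k) := fun k => by
    induction k with
    | zero => exact hT
    | succ k ih => exact (hs k).isGeometricTriangulation ih
  have hanti : StrictAnti fun k => totalWeight V (s k) :=
    strictAnti_nat_of_succ_lt fun k => (hs k).totalWeight_lt hV (hg k)
  exact not_strictAnti_of_wellFoundedLT _ hanti

theorem exists_isFlipOutput [DiscreteTopology L] [IsZLattice ℝ L] (hV : V.Finite)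
    (hT : IsGeometricTriangulation L V T) : ∃ T', IsFlipOutput L T T' := by
  induction hn : totalWeight V T using Nat.strong_induction_on generalizing T with
  | _ n ih =>
    by_cases hex : ∃ a b c d : Plane, DelaunayFlippable L T a b c d
    · obtain ⟨a, b, c, d, hf⟩ := hex
      have hflip : DelaunayFlip L T (flip L T a b c d) := ⟨a, b, c, d, hf, rfl⟩
      obtain ⟨T', h1, h2⟩ := ih _ (hn ▸ hflip.totalWeight_lt hV hT)
        (hflip.isGeometricTriangulation hT) rfl
      exact ⟨T', Relation.ReflTransGen.head hflip h1, h2⟩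
    · exact ⟨T, Relation.ReflTransGen.refl, hex⟩

theorem isGeometricTriangulation_of_reflTransGen {T' : Set (TorusFace L)}
    (h : Relation.ReflTransGen (DelaunayFlip L) T T') (hT : IsGeometricTriangulation L V T) :
    IsGeometricTriangulation L V T' := by
  induction h with
  | refl => exact hT
  | tail _ h ih => exact h.isGeometricTriangulation ih

/-! ### From locally Delaunay to Delaunay -/

/-- The cotangent of the angle under which `p` sees the segment `ab`. -/
noncomputable def viewCot (p a b : Plane) : ℝ :=
  ((a 0 - p 0) * (b 0 - p 0) + (a 1 - p 1) * (b 1 - p 1)) / |cr a b p|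

theorem viewCot_comm (p a b : Plane) : viewCot p b a = viewCot p a b := by
  unfold viewCot
  rw [cr_swap, abs_neg, mul_comm (b 0 - p 0), mul_comm (b 1 - p 1)]

/-- A point inside the circumcircle of `abd`, on the side of `d` of the line `ab`, that lies strictly
beyond the line `bd` lies strictly on the inner side of `da`. -/
theorem pos_of_barycentric_neg {p : Plane} {m : ℝ × ℝ × ℝ} (ma : pw m a = 0) (mb : pw m b = 0)
    (md : pw m d = 0) (mp : pw m p < 0) {α β γ : ℝ} (hs : α + β + γ = 1)
    (h0 : p 0 = α * a 0 + β * b 0 + γ * d 0) (h1 : p 1 = α * a 1 + β * b 1 + γ * d 1)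
    (hγ : 0 < γ) (hα : α < 0) : 0 < β := by
  by_contra hβ
  have := pw_le_of_barycentric m (x := d) (a := p) (b := a) (c := b) (α := 1 / γ) (β := -α / γ)
    (γ := -β / γ) (by field_simp; linarith) (by positivity) (div_nonneg (by linarith) hγ.le)
    (div_nonneg (by linarith) hγ.le) (by field_simp; linarith) (by field_simp; linarith)
  rw [ma, mb, md] at this
  have : 1 / γ * pw m p < 0 := mul_neg_of_pos_of_neg (by positivity) mp
  linarith

/-- The signs of the weights say that the segment from `p` to `a` crosses `bd`, so the angle `apb`
is a proper part of the angle `bpd`. The cotangent decreases with the angle. -/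
theorem viewCot_lt {p : Plane} {α β γ : ℝ} (hD : 0 < cr a b d) (hs : α + β + γ = 1)
    (h0 : p 0 = α * a 0 + β * b 0 + γ * d 0) (h1 : p 1 = α * a 1 + β * b 1 + γ * d 1)
    (hγ : 0 < γ) (hα : α < 0) (hβ : 0 < β) : viewCot p b d < viewCot p a b := by
  have k1 := cr_barycentric a b hs h0 h1
  have k2 := cr_barycentric b d hs h0 h1
  have k3 := cr_barycentric d a hs h0 h1
  rw [cr_self_left, cr_self_right] at k1 k2 k3
  rw [cr_rotate a b d] at k2
  rw [← cr_rotate d a b] at k3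
  have e1 : cr a b p = γ * cr a b d := by linarith
  have e2 : cr b d p = α * cr a b d := by linarith
  have e3 : cr d a p = β * cr a b d := by linarith
  have p1 : 0 < cr a b p := by rw [e1]; positivity
  have p2 : cr b d p < 0 := by rw [e2]; exact mul_neg_of_neg_of_pos hα hD
  have p3 : 0 < cr d a p := by rw [e3]; positivity
  have hpb : 0 < (b 0 - p 0) ^ 2 + (b 1 - p 1) ^ 2 := by
    by_contra hcon
    have q0 : b 0 - p 0 = 0 := by nlinarith [sq_nonneg (b 0 - p 0), sq_nonneg (b 1 - p 1)]
    have q1 : b 1 - p 1 = 0 := by nlinarith [sq_nonneg (b 0 - p 0), sq_nonneg (b 1 - p 1)]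
    have : p = b := plane_ext (by linarith) (by linarith)
    rw [this, cr_self_right] at p1
    exact lt_irrefl _ p1
  unfold viewCot
  rw [abs_of_pos p1, abs_of_neg p2, div_lt_div_iff₀ (by linarith) p1, ← sub_pos]
  have key : ((a 0 - p 0) * (b 0 - p 0) + (a 1 - p 1) * (b 1 - p 1)) * -cr b d p -
      ((b 0 - p 0) * (d 0 - p 0) + (b 1 - p 1) * (d 1 - p 1)) * cr a b p =
      cr d a p * ((b 0 - p 0) ^ 2 + (b 1 - p 1) ^ 2) := by
    unfold cr
    ring
  rw [key]
  positivity

theorem exists_viewCot_lt_of_pos {p : Plane} {m : ℝ × ℝ × ℝ} (ma : pw m a = 0) (mb : pw m b = 0)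
    (md : pw m d = 0) (mp : pw m p < 0) (hD : 0 < cr a b d) (hp : 0 < cr a b p)
    (hh : p ∉ convexHull ℝ {a, b, d}) : ∃ x y z, ({x, y, z} : Set Plane) = {a, b, d} ∧
      cr x y z * cr x y p < 0 ∧ viewCot p x y < viewCot p a b := by
  obtain ⟨α, β, γ, hs, h0, h1⟩ := exists_barycentric hD.ne' p
  have k1 := cr_barycentric a b hs h0 h1
  have k2 := cr_barycentric b d hs h0 h1
  have k3 := cr_barycentric d a hs h0 h1
  rw [cr_self_left, cr_self_right] at k1 k2 k3
  rw [cr_rotate a b d] at k2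
  rw [← cr_rotate d a b] at k3
  have hγ : 0 < γ := by
    by_contra h
    nlinarith
  rcases lt_or_ge α 0 with hα | hα
  · have hβ := pos_of_barycentric_neg ma mb md mp hs h0 h1 hγ hα
    refine ⟨b, d, a, ?_, ?_, viewCot_lt hD hs h0 h1 hγ hα hβ⟩
    · rw [Set.pair_comm, Set.insert_comm]
    · rw [cr_rotate]
      apply mul_neg_of_pos_of_neg hD
      nlinarith
  · have hβ : β < 0 := by
      by_contra hβ
      exact hh (mem_hull_triple.mpr ⟨α, β, γ, hα, not_lt.mp hβ, hγ.le, hs, h0, h1⟩)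
    have hα' := pos_of_barycentric_neg (α := β) (β := α) mb ma md mp (by linarith) (by linarith)
      (by linarith) hγ hβ
    refine ⟨d, a, b, ?_, ?_, ?_⟩
    · rw [Set.insert_comm, Set.pair_comm]
    · rw [← cr_rotate d a b]
      apply mul_neg_of_pos_of_neg hD
      nlinarith
    · -- reflect the plane to exchange the roles of `a` and `b`
      let r : Plane → Plane := fun x => !₂[x 1, x 0]
      have hcr : ∀ x y z, cr (r x) (r y) (r z) = cr y x z := by
        intro x y z; simp only [cr, r]; simp; ring
      have hv : ∀ x y, viewCot (r p) (r x) (r y) = viewCot p x y := by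
        intro x y
        unfold viewCot
        rw [hcr, cr_swap, abs_neg]
        simp [r, add_comm]
      have := viewCot_lt (a := r b) (b := r a) (d := r d) (p := r p) (α := β) (β := α) (γ := γ)
        (by rwa [hcr]) (by linarith) (by simp [r]; linarith) (by simp [r]; linarith) hγ hβ hα'
      rwa [hv, hv, viewCot_comm p a b, viewCot_comm p d a] at this

/-- A point inside a circumcircle sees some farther edge under a larger angle. -/
theorem exists_viewCot_lt {p : Plane} {m : ℝ × ℝ × ℝ} (ma : pw m a = 0) (mb : pw m b = 0)
    (md : pw m d = 0) (mp : pw m p < 0) (hp : 0 < cr a b d * cr a b p)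
    (hh : p ∉ convexHull ℝ {a, b, d}) : ∃ x y z, ({x, y, z} : Set Plane) = {a, b, d} ∧
      cr x y z * cr x y p < 0 ∧ viewCot p x y < viewCot p a b := by
  rcases mul_pos_iff.mp hp with ⟨h1, h2⟩ | ⟨h1, h2⟩
  · exact exists_viewCot_lt_of_pos ma mb md mp h1 h2 hh
  · rw [Set.insert_comm] at hh ⊢
    rw [← viewCot_comm p a b]
    exact exists_viewCot_lt_of_pos mb ma md mp (by rw [cr_swap]; linarith)
      (by rw [cr_swap]; linarith) hh

theorem IsTriangle.exists_separating_edge {t : Set Plane} (h : IsTriangle t) {p : Plane}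
    (hp : p ∉ convexHull ℝ t) : ∃ a b c, t = {a, b, c} ∧ cr a b c * cr a b p < 0 := by
  obtain ⟨a, b, c, hcr, rfl⟩ := h.exists_cr_pos
  by_contra! hcon
  refine hp (mem_hull_of_cr hcr ?_ ?_ ?_)
  · have := hcon a b c rfl
    exact nonneg_of_mul_nonneg_right this hcr
  · have := hcon b c a (by rw [Set.pair_comm c, Set.insert_comm])
    rw [cr_rotate] at this
    exact nonneg_of_mul_nonneg_right this hcr
  · have := hcon c a b (by rw [Set.insert_comm c a, Set.pair_comm c b])
    rw [← cr_rotate c a b] at this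
    exact nonneg_of_mul_nonneg_right this hcr

/-- Powers of points beyond a common edge `ab` with respect to the circles of `abc` and `abd`. -/
theorem mul_pw_sub_neighbor {m n : ℝ × ℝ × ℝ} (ma : pw m a = 0) (mb : pw m b = 0)
    (na : pw n a = 0) (nb : pw n b = 0) (nd : pw n d = 0) (p : Plane) :
    cr a b d * (pw m p - pw n p) = cr a b p * pw m d := by
  rw [pw_sub_cr m n (ma.trans na.symm) (mb.trans nb.symm), nd, sub_zero]

/-- The affine difference of the two powers vanishes on the line `ab`, so on the side of `d` it has
the sign it takes at `d`. -/
theorem pw_le_neighbor {m n : ℝ × ℝ × ℝ} (ma : pw m a = 0) (mb : pw m b = 0)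
    (na : pw n a = 0) (nb : pw n b = 0) (nd : pw n d = 0) {p : Plane}
    (h : 0 < cr a b d * cr a b p) (md : 0 ≤ pw m d) : pw n p ≤ pw m p := by
  have := mul_pw_sub_neighbor ma mb na nb nd p
  rcases mul_pos_iff.mp h with ⟨h1, h2⟩ | ⟨h1, h2⟩ <;> nlinarith

theorem pw_lt_neighbor {m n : ℝ × ℝ × ℝ} (ma : pw m a = 0) (mb : pw m b = 0)
    (na : pw n a = 0) (nb : pw n b = 0) (nd : pw n d = 0) {p : Plane}
    (h : 0 < cr a b d * cr a b p) (md : 0 < pw m d) : pw n p < pw m p := by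
  refine lt_of_le_of_ne (pw_le_neighbor ma mb na nb nd h md.le) fun e => ?_
  have := mul_pw_sub_neighbor ma mb na nb nd p
  rw [e, sub_self, mul_zero] at this
  exact mul_ne_zero (right_ne_zero_of_mul h.ne') md.ne' this.symm

theorem mul_pos_of_opposite {x y z : ℝ} (h1 : x * y < 0) (h2 : x * z < 0) : 0 < y * z := by
  have := mul_pos_of_neg_of_neg h1 h2
  by_contra hcon
  nlinarith [mul_self_nonneg x]

/-- A triangulation without flippable edges has empty circumdisks. -/
theorem IsGeometricTriangulation.not_inDisk [DiscreteTopology L] [IsZLattice ℝ L]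
    (hT : IsGeometricTriangulation L V T) (hV : V.Finite)
    (hloc : ∀ a b c d, AdjacentLifts L T a b c d → ¬ InDisk {a, b, c} d)
    {t : Set Plane} (ht : t ∈ lifts L T) {p : Plane} (hp : p ∈ ⋃₀ lifts L T) : ¬ InDisk t p := by
  intro hin
  have hout : ∀ s ∈ lifts L T, InDisk s p → p ∉ convexHull ℝ s := by
    rintro s hs ⟨m, hm, hmp⟩ hps
    exact hmp.ne (hm p (hT.mem_of_mem_hull hp hs hps))
  -- The strict separation keeps `p` off the line of each edge, so the denominators in `viewCot` are
  -- nonzero.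
  let E : Set (Plane × Plane) := {e | ∃ c, {e.1, e.2, c} ∈ lifts L T ∧ InDisk {e.1, e.2, c} p ∧
    cr e.1 e.2 c * cr e.1 e.2 p < 0}
  have hfinV : (⋃ s ∈ {s ∈ lifts L T | InDisk s p}, s).Finite :=
    (hT.finite_inDisk hV p).biUnion fun s hs => by
      obtain ⟨a, b, c, -, rfl⟩ := (hT.isTriangle s hs.1).exists_cr
      exact Set.toFinite _
  have hE : E.Finite := by
    refine (hfinV.prod hfinV).subset ?_
    rintro ⟨a, b⟩ ⟨c, h1, h2, -⟩
    exact ⟨Set.mem_iUnion₂.mpr ⟨_, ⟨h1, h2⟩, by simp⟩, Set.mem_iUnion₂.mpr ⟨_, ⟨h1, h2⟩, by simp⟩⟩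
  have hne : E.Nonempty := by
    obtain ⟨a, b, c, rfl, h⟩ := (hT.isTriangle t ht).exists_separating_edge (hout t ht hin)
    exact ⟨(a, b), c, ht, hin, h⟩
  -- The edge seen under the largest angle.
  obtain ⟨⟨a, b⟩, ⟨c, hc, hcin, hsep⟩, hmin⟩ :=
    hE.exists_minimalFor (fun e => viewCot p e.1 e.2) E hne
  simp only at hc hcin hsep
  obtain ⟨d, hd, hcd⟩ := hT.exists_neighbor hV hc
  obtain ⟨m, ma, mb, mc, mp⟩ := inDisk_triple.mp hcin
  obtain ⟨n, na, nb, nd⟩ := exists_circle (hT.cr_ne_zero hd)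
  have hside := mul_pos_of_opposite (hT.opposite hc hd hcd) hsep
  have md : 0 ≤ pw m d := by
    by_contra hcon
    exact hloc a b c d ⟨hc, by rw [Set.insert_comm]; exact hd, hcd⟩
      (inDisk_triple.mpr ⟨m, ma, mb, mc, not_le.mp hcon⟩)
  have np : pw n p < 0 := (pw_le_neighbor ma mb na nb nd hside md).trans_lt mp
  have hdin : InDisk {a, b, d} p := inDisk_triple.mpr ⟨n, na, nb, nd, np⟩
  obtain ⟨x, y, z, e, h1, h2⟩ := exists_viewCot_lt na nb nd np hside (hout _ hd hdin)
  rw [← e] at hd hdin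
  exact absurd (hmin (j := (x, y)) ⟨z, hd, hdin, h1⟩ h2.le) (not_le.mpr h2)

theorem isDelaunay_iff (hT : IsGeometricTriangulation L V T) : IsDelaunay L T ↔
    ∀ t ∈ lifts L T, ∀ p ∈ ⋃₀ lifts L T, ¬ InDisk t p := by
  constructor
  · rintro h t ht p hp hin
    obtain ⟨o, r, hs, hd⟩ := h t ht
    obtain ⟨a, b, c, hcr, rfl⟩ := (hT.isTriangle t ht).exists_cr
    have hr : 0 ≤ r := by
      have := hs (Set.mem_insert a _)
      rw [Metric.mem_sphere] at this
      rw [← this]; exact dist_nonneg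
    obtain ⟨m, hm⟩ := exists_pw_eq o r
    have key := sphere_iff_pw hr hm
    have hpm := (inDisk_triple_iff hcr ((key a).1.mp (hs (by simp)))
      ((key b).1.mp (hs (by simp))) ((key c).1.mp (hs (by simp)))).mp hin
    exact Set.disjoint_left.mp hd ((key p).2.1.mpr hpm) hp
  · intro h t ht
    obtain ⟨a, b, c, hcr, rfl⟩ := (hT.isTriangle t ht).exists_cr
    obtain ⟨m, ma, mb, mc⟩ := exists_circle hcr
    obtain ⟨o, r, hr, hm⟩ := exists_center ma
    have key := sphere_iff_pw hr hm
    refine ⟨o, r, ?_, ?_⟩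
    · rintro q (rfl | rfl | rfl)
      · exact (key _).1.mpr ma
      · exact (key _).1.mpr mb
      · exact (key _).1.mpr mc
    · rw [Set.disjoint_left]
      intro p hp hpV
      exact h _ ht p hpV (inDisk_triple.mpr ⟨m, ma, mb, mc, (key p).2.1.mp hp⟩)

theorem isDelaunay_of_not_flippable [DiscreteTopology L] [IsZLattice ℝ L] (hV : V.Finite)
    (hT : IsGeometricTriangulation L V T)
    (h : ¬ ∃ a b c d : Plane, DelaunayFlippable L T a b c d) : IsDelaunay L T :=
  (isDelaunay_iff hT).mpr fun _ ht _ hp => hT.not_inDisk hV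
    (fun a b c d hadj hin => h ⟨a, b, c, d, hadj.flippable_of_inDisk hT hin⟩) ht hp

/-! ### Uniqueness in the non-degenerate case -/

theorem pw_eq_of_isOpen {U : Set Plane} (hU : IsOpen U) (hne : U.Nonempty) {m n : ℝ × ℝ × ℝ}
    (h : ∀ x ∈ U, pw m x = pw n x) (x : Plane) : pw m x = pw n x := by
  obtain ⟨y, hy⟩ := hne
  have key : ∀ w : Plane, ∀ᶠ ε in nhdsWithin (0 : ℝ) (Set.Ioi 0), y + ε • w ∈ U := by
    intro w
    have hc : Continuous fun ε : ℝ => y + ε • w := by fun_prop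
    have h0 := hc.tendsto 0
    simp only [zero_smul, add_zero] at h0
    exact (h0.mono_left nhdsWithin_le_nhds).eventually (hU.mem_nhds hy)
  obtain ⟨ε, ⟨h1, h2⟩, h3⟩ :=
    (((key !₂[1, 0]).and (key !₂[0, 1])).and self_mem_nhdsWithin).exists
  refine circle_unique (a := y) ?_ (h _ hy) (h _ h1) (h _ h2) x
  have h3' : 0 < ε := h3
  simp [cr, h3'.ne']

theorem IsTriangle.interior_nonempty {t : Set Plane} (h : IsTriangle t) :
    (interior (convexHull ℝ t)).Nonempty := by
  obtain ⟨a, b, c, hi, rfl⟩ := h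
  rw [interior_convexHull_nonempty_iff_affineSpan_eq_top]
  have := hi.affineSpan_eq_top_iff_card_eq_finrank_add_one.mpr (by simp)
  rwa [Matrix.range_cons, Matrix.range_cons, Matrix.range_cons, Matrix.range_empty,
    Set.union_empty, Set.singleton_union, Set.singleton_union] at this

/-- The boundaries of the finitely many triangles near an interior point of `t` have measure zero,
so some nearby interior point avoids them; the triangle covering it has it in its interior. -/
theorem IsGeometricTriangulation.exists_overlap [DiscreteTopology L] [IsZLattice ℝ L]
    (hT : IsGeometricTriangulation L V T) (hV : V.Finite) {t : Set Plane} (ht : IsTriangle t) :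
    ∃ s ∈ lifts L T, (interior (convexHull ℝ t) ∩ interior (convexHull ℝ s)).Nonempty := by
  obtain ⟨x, hx⟩ := ht.interior_nonempty
  have hfin := hT.finite_near hV x 1
  set N := {s ∈ lifts L T | ∃ y ∈ convexHull ℝ s, dist y x ≤ 1}
  set U := interior (convexHull ℝ t) ∩ Metric.ball x 1
  have hU : IsOpen U := isOpen_interior.inter Metric.isOpen_ball
  have hpos : 0 < MeasureTheory.volume U :=
    hU.measure_pos _ ⟨x, hx, Metric.mem_ball_self one_pos⟩
  have hnull : MeasureTheory.volume (⋃ s ∈ N, frontier (convexHull ℝ s)) = 0 :=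
    (MeasureTheory.measure_biUnion_null_iff hfin.countable).mpr fun s _ =>
      (convex_convexHull ℝ s).addHaar_frontier _
  obtain ⟨y, ⟨hy1, hy2⟩, hy3⟩ : (U \ ⋃ s ∈ N, frontier (convexHull ℝ s)).Nonempty := by
    rw [Set.nonempty_iff_ne_empty, Ne, Set.sdiff_eq_empty]
    exact fun hsub => hpos.ne' (MeasureTheory.measure_mono_null hsub hnull)
  obtain ⟨s, hs, hys⟩ := Set.mem_iUnion₂.mp (hT.cover.symm ▸ Set.mem_univ y)
  refine ⟨s, hs, y, hy1, ?_⟩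
  by_contra hcon
  exact hy3 (Set.mem_iUnion₂.mpr ⟨s, ⟨hs, y, hys, (Metric.mem_ball.mp hy2).le⟩,
    subset_closure hys, hcon⟩)

theorem pw_le_of_mem_hull {m n : ℝ × ℝ × ℝ} (ma : pw m a = 0) (mb : pw m b = 0) (mc : pw m c = 0)
    (na : 0 ≤ pw n a) (nb : 0 ≤ pw n b) (nc : 0 ≤ pw n c) {x : Plane}
    (hx : x ∈ convexHull ℝ {a, b, c}) : pw m x ≤ pw n x := by
  obtain ⟨α, β, γ, hα, hβ, hγ, hs, h0, h1⟩ := mem_hull_triple.mp hx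
  have := pw_sub_barycentric n m hs h0 h1
  rw [ma, mb, mc] at this
  have : 0 ≤ α * (pw n a - 0) + β * (pw n b - 0) + γ * (pw n c - 0) := by
    simp only [sub_zero]
    positivity
  linarith

theorem IsTriangle.eq_of_subset {s t : Set Plane} (hs : IsTriangle s) (ht : IsTriangle t)
    (h : s ⊆ t) : s = t := by
  obtain ⟨a, b, c, hcr, rfl⟩ := hs.exists_cr
  obtain ⟨h1, h2, h3⟩ := ne_of_cr_ne_zero hcr
  obtain ⟨r, rfl, -⟩ := ht.exists_eq_insert_insert (h (by simp)) (h (by simp)) h1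
  have hc : c ∈ ({a, b, r} : Set Plane) := h (by simp)
  rcases hc with e | e | e
  · exact absurd e.symm h2
  · exact absurd e.symm h3
  · rw [Set.mem_singleton_iff.mp e]

theorem IsGeometricTriangulation.mem_vertices_iff {S : Set (TorusFace L)}
    (hS : IsGeometricTriangulation L V S) (hT : IsGeometricTriangulation L V T) (p : Plane) :
    p ∈ ⋃₀ lifts L S ↔ p ∈ ⋃₀ lifts L T := by
  rw [hS.vertices, hT.vertices]

/-- In the non-degenerate case, overlapping Delaunay triangles are equal. -/
theorem eq_of_overlap [DiscreteTopology L] [IsZLattice ℝ L] (hV : V.Finite)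
    {S : Set (TorusFace L)} (hS : IsDelaunayTriangulation L V S)
    (hT : IsDelaunayTriangulation L V T) (hnd : NonDegenerate L V) {s t : Set Plane}
    (hs : s ∈ lifts L S) (ht : t ∈ lifts L T)
    (hov : (interior (convexHull ℝ s) ∩ interior (convexHull ℝ t)).Nonempty) : s = t := by
  have dS := (isDelaunay_iff hS.1).mp hS.2
  have dT := (isDelaunay_iff hT.1).mp hT.2
  refine (hS.1.isTriangle s hs).eq_of_subset (hT.1.isTriangle t ht) ?_
  -- Each power function vanishes at its own vertices and, by emptiness of its disk, is nonnegative
  -- at those of the other triangle. So each is at most the other on its own triangle, and they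
  -- agree on the open overlap.
  obtain ⟨m, hms, hmt⟩ : ∃ m, (∀ q ∈ s, pw m q = 0) ∧ ∀ q ∈ t, pw m q = 0 := by
    obtain ⟨a, b, c, hcr, rfl⟩ := (hS.1.isTriangle s hs).exists_cr
    obtain ⟨a', b', c', hcr', rfl⟩ := (hT.1.isTriangle t ht).exists_cr
    obtain ⟨m, ma, mb, mc⟩ := exists_circle hcr
    obtain ⟨n, na, nb, nc⟩ := exists_circle hcr'
    have hm : ∀ q ∈ ({a', b', c'} : Set Plane), 0 ≤ pw m q := fun q hq => by
      by_contra hcon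
      exact dS _ hs q ((hS.1.mem_vertices_iff hT.1 q).mpr ⟨_, ht, hq⟩)
        (inDisk_triple.mpr ⟨m, ma, mb, mc, not_le.mp hcon⟩)
    have hn : ∀ q ∈ ({a, b, c} : Set Plane), 0 ≤ pw n q := fun q hq => by
      by_contra hcon
      exact dT _ ht q ((hS.1.mem_vertices_iff hT.1 q).mp ⟨_, hs, hq⟩)
        (inDisk_triple.mpr ⟨n, na, nb, nc, not_le.mp hcon⟩)
    have hmn := pw_eq_of_isOpen (isOpen_interior.inter isOpen_interior) hov (m := m) (n := n)
      fun x hx => le_antisymm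
        (pw_le_of_mem_hull ma mb mc (hn a (by simp)) (hn b (by simp)) (hn c (by simp))
          (interior_subset hx.1))
        (pw_le_of_mem_hull na nb nc (hm a' (by simp)) (hm b' (by simp)) (hm c' (by simp))
          (interior_subset hx.2))
    refine ⟨m, ?_, ?_⟩
    · rintro q (rfl | rfl | rfl) <;> assumption
    · rintro q (rfl | rfl | rfl) <;> rwa [hmn]
  intro p hp
  have hpT : p ∈ ⋃₀ lifts L T := (hS.1.mem_vertices_iff hT.1 p).mp ⟨s, hs, hp⟩
  by_contra hpt
  obtain ⟨a, b, c, rfl, hsep⟩ := (hT.1.isTriangle t ht).exists_separating_edge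
    fun h => hpt (hT.1.mem_of_mem_hull hpT ht h)
  obtain ⟨d, hd, hcd⟩ := hT.1.exists_neighbor hV ht
  have hside := mul_pos_of_opposite (hT.1.opposite ht hd hcd) hsep
  have hadj : AdjacentLifts L T a b c d := ⟨ht, by rw [Set.insert_comm]; exact hd, hcd⟩
  have ma := hmt a (by simp)
  have mb := hmt b (by simp)
  have mc := hmt c (by simp)
  obtain ⟨n, na, nb, nd⟩ := exists_circle (hT.1.cr_ne_zero hd)
  -- The vertex `d` cannot be inside the common circle (Delaunay) or on it (non-degeneracy). If it
  -- is outside, then `p`, which is on that circle and beyond `ab`, falls inside the circle of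
  -- `abd`.
  rcases lt_trichotomy (pw m d) 0 with md | md | md
  · exact dT _ ht d ⟨_, hd, by simp⟩ (inDisk_triple.mpr ⟨m, ma, mb, mc, md⟩)
  · obtain ⟨o, r, hr, hm⟩ := exists_center ma
    refine hnd T hT a b c d hadj ⟨o, r, ?_⟩
    rintro q (rfl | rfl | rfl | rfl) <;> exact (sphere_iff_pw hr hm _).1.mpr (by assumption)
  · refine dT _ hd p hpT (inDisk_triple.mpr ⟨n, na, nb, nd, ?_⟩)
    exact (pw_lt_neighbor ma mb na nb nd hside md).trans_eq (hms p hp)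

theorem delaunay_unique [DiscreteTopology L] [IsZLattice ℝ L] (hV : V.Finite)
    {S : Set (TorusFace L)} (hS : IsDelaunayTriangulation L V S)
    (hT : IsDelaunayTriangulation L V T) (hnd : NonDegenerate L V) : S = T := by
  ext F
  obtain ⟨t, rfl⟩ := Quotient.exists_rep F
  constructor
  · intro ht
    obtain ⟨s, hs, hov⟩ := hT.1.exists_overlap hV (hS.1.isTriangle t ht)
    rw [eq_of_overlap hV hS hT hnd ht hs hov]
    exact hs
  · intro ht
    obtain ⟨s, hs, hov⟩ := hS.1.exists_overlap hV (hT.1.isTriangle t ht)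
    rw [Set.inter_comm] at hov
    rw [← eq_of_overlap hV hS hT hnd hs ht hov]
    exact hs

end FlatTorus

theorem mainTheorem4 (L : Submodule ℤ FlatTorus.Plane) [DiscreteTopology L] [IsZLattice ℝ L]
    (V : Set (FlatTorus.Torus L)) (hV : V.Finite)
    (T : Set (FlatTorus.TorusFace L)) (hT : FlatTorus.IsGeometricTriangulation L V T) :
    (¬ ∃ s : ℕ → Set (FlatTorus.TorusFace L),
        s 0 = T ∧ ∀ k, FlatTorus.DelaunayFlip L (s k) (s (k + 1))) ∧
    (∃ T', FlatTorus.IsFlipOutput L T T') ∧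
    ∀ T', FlatTorus.IsFlipOutput L T T' →
      FlatTorus.IsDelaunayTriangulation L V T' ∧
      (FlatTorus.NonDegenerate L V →
        ∀ S, FlatTorus.IsDelaunayTriangulation L V S → S = T') := by
  refine ⟨FlatTorus.not_exists_infinite_flips hV hT, FlatTorus.exists_isFlipOutput hV hT, ?_⟩
  rintro T' ⟨hreach, hno⟩
  have hT' := FlatTorus.isGeometricTriangulation_of_reflTransGen hreach hT
  have hD : FlatTorus.IsDelaunayTriangulation L V T' :=
    ⟨hT', FlatTorus.isDelaunay_of_not_flippable hV hT' hno⟩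
  exact ⟨hD, fun hnd S hS => FlatTorus.delaunay_unique hV hS hD hnd⟩
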